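/- \textbf{Sign patterns in the set of fluxes of a torus.} Colour the unit squares with vertices in $\mathbb Z^2$ black and white like a chessboard, with $[0,1]^2$ black. Let $L\subset\mathbb Z^2$ be a valid lattice: $L$ is generated by two linearly independent integer vectors, each with even coordinate sum. A tiling of the torus $\mathbb R^2/L$ is an $L$-periodic domino tiling of the plane. \emph{Flux.} The height function $h_t:\mathbb Z^2\to\mathbb Z$ of a tiling $t$ has $h_t(0)=0$ and, along an oriented unit edge with a black square on its right, changes by $+1$ if the edge crosses no domino of $t$ and by $-3$ if it crosses one (so by $-1$, respectively $+3$, if the square on the right is white). The flux of $t$ is the vector $\varphi_t\in\mathbb R^2$ with $h_t(u+v)-h_t(u)=4\langle\varphi_t,v\rangle$ for all $u\in\mathbb Z^2$, $v\in L$. Let $\mathscr F(L)$ be the set of fluxes of all tilings of $\mathbb R^2/L$. \emph{Signs.} Enumerate the black squares and the white squares of a fundamental domain of $L$ (equivalently, representatives modulo $L$ of each colour) by $1,\dots,n$. A tiling $t$ matches the $i$-th black square, modulo $L$, with the $\sigma_t(i)$-th white square, where $\sigma_t\in S_n$. Give each domino that consists of a black square and the white square immediately to its right the Kasteleyn sign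 $-1$, and every other domino the Kasteleyn sign $+1$. The sign of $t$ is its sign in the expansion of the Kasteleyn determinant: $\operatorname{sgn}(t)=\operatorname{sgn}(\sigma_t)$ times the product of the Kasteleyn signs of the dominoes of $t$ (one from each $L$-class). \emph{Bases and lines.} Let $L^*=\{\varphi\in\mathbb R^2:\langle\varphi,v\rangle\in\mathbb Z\ \text{for all } v\in L\}$, and let $\{v_0^*,v_1^*\}$ be a flux-connecting basis of $L^*$: a $\mathbb Z$-basis such that any two elements of $\mathscr F(L)$ are joined by a finite sequence in $\mathscr F(L)$ whose consecutive differences lie in $\{\pm v_0^*,\pm v_1^*\}$. Two distinct fluxes on a line are adjacent if no flux lies strictly between them on that line; two distinct parallel lines through fluxes are adjacent if no line parallel to them and strictly between them contains a flux. Then $\operatorname{sgn}(t)$ depends only on the flux of $t$, so $\operatorname{sgn}(\varphi)$ is well defined for $\varphi\in\mathscr F(L)$, and for each $i\in\{0,1\}$: \begin{enumerate} \item along any line parallel to $v_i^*$, the sign change between adjacent fluxes is constant: if $\varphi,\varphi'$ and $\psi,\psi'$ are pairs of adjacent fluxes on one same line parallel to $v_i^*$, then $\operatorname{sgn}(\varphi)/\operatorname{sgn}(\varphi')=\operatorname{sgn}(\psi)/\operatorname{sgn}(\psi')$;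 \item on adjacent lines parallel to $v_i^*$ the sign change is opposite: if $\varphi,\varphi'$ are adjacent fluxes on one of the lines and $\psi,\psi'$ are adjacent fluxes on the other, then $\operatorname{sgn}(\varphi)/\operatorname{sgn}(\varphi')=-\operatorname{sgn}(\psi)/\operatorname{sgn}(\psi')$. \end{enumerate} Consequently there is an odd-one-out sign $\varepsilon\in\{\pm1\}$, always surrounded by different signs: if $\varphi\in\mathscr F(L)$ has sign $\varepsilon$, then every flux $\varphi+a v_0^*+b v_1^*\in\mathscr F(L)$ with $a,b\in\{-1,0,1\}$ not both $0$ has sign $-\varepsilon$; and whenever $\varphi,\ \varphi+v_0^*,\ \varphi+v_1^*,\ \varphi+v_0^*+v_1^*$ all lie in $\mathscr F(L)$, exactly one of these four fluxes has sign $\varepsilon$. -/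

import Mathlib

/-! Domino tilings of the torus `ℝ² / L`.  The unit square `[x, x+1] × [y, y+1]` of the plane is
represented by its lower left corner `(x, y) : ℤ × ℤ`; vertices of the square lattice are also
elements of `ℤ × ℤ`.  The square `[0, 1]²` is black. -/

namespace DominoTorus

/-- The inner product of a vector of the real plane with an integer vector. -/
noncomputable def pairing (φ : ℝ × ℝ) (v : ℤ × ℤ) : ℝ := φ.1 * v.1 + φ.2 * v.2

/-- A valid lattice: generated by two linearly independent integer vectors, each of them with
coordinates of equal parity (so that translations by `L` preserve the colours of squares). -/
def IsValidLattice (L : AddSubgroup (ℤ × ℤ)) : Prop :=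
  ∃ v₀ v₁ : ℤ × ℤ, L = AddSubgroup.closure {v₀, v₁} ∧ v₀.1 * v₁.2 - v₀.2 * v₁.1 ≠ 0 ∧
    Even (v₀.1 + v₀.2) ∧ Even (v₁.1 + v₁.2)

/-- The dual lattice `L^* = Hom(L, ℤ)`, seen in the plane through the inner product. -/
def dualLattice (L : AddSubgroup (ℤ × ℤ)) : AddSubgroup (ℝ × ℝ) where
  carrier := {φ | ∀ v ∈ L, ∃ k : ℤ, pairing φ v = k}
  zero_mem' := fun v _ => ⟨0, by simp [pairing]⟩
  add_mem' := by
    intro a b ha hb v hv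
    obtain ⟨k, hk⟩ := ha v hv
    obtain ⟨l, hl⟩ := hb v hv
    refine ⟨k + l, ?_⟩
    push_cast
    rw [← hk, ← hl]
    simp only [pairing, Prod.fst_add, Prod.snd_add]
    ring
  neg_mem' := by
    intro a ha v hv
    obtain ⟨k, hk⟩ := ha v hv
    refine ⟨-k, ?_⟩
    push_cast
    rw [← hk]
    simp only [pairing, Prod.fst_neg, Prod.snd_neg]
    ring

/-- The square with lower left corner `s` is black (otherwise it is white). -/
def IsBlack (s : ℤ × ℤ) : Prop := Even (s.1 + s.2)

/-- Two squares share an edge. -/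
def AreAdjacent (s p : ℤ × ℤ) : Prop :=
  p = s + (1, 0) ∨ p = s - (1, 0) ∨ p = s + (0, 1) ∨ p = s - (0, 1)

/-- A domino tiling of the torus `ℝ² / L`, that is, an `L`-periodic domino tiling of the plane:
`partner s` is the other square of the domino that contains the square `s`. -/
structure Tiling (L : AddSubgroup (ℤ × ℤ)) where
  partner : ℤ × ℤ → ℤ × ℤ
  adjacent : ∀ s, AreAdjacent s (partner s)
  involutive : ∀ s, partner (partner s) = s
  periodic : ∀ s, ∀ v ∈ L, partner (s + v) = partner s + v

variable {L : AddSubgroup (ℤ × ℤ)}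

open Classical in
/-- The height change along an edge of the square lattice that is traversed with the square `r`
on its right and the square `l` on its left.  It is `1` if `r` is black and `-1` if `r` is white
when the edge does not cross a domino, and `-3`, respectively `3`, when it does. -/
noncomputable def heightStep (t : Tiling L) (r l : ℤ × ℤ) : ℤ :=
  (if IsBlack r then 1 else -1) * (if t.partner r = l then -3 else 1)

/-- `h` is the height function of the tiling `t`, with base value `0` at the origin. -/
def IsHeightFunction (t : Tiling L) (h : ℤ × ℤ → ℤ) : Prop :=
  h 0 = 0 ∧
  (∀ x y : ℤ, h (x, y + 1) - h (x, y) = heightStep t (x, y) (x - 1, y)) ∧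
  (∀ x y : ℤ, h (x + 1, y) - h (x, y) = heightStep t (x, y - 1) (x, y))

/-- The vector `φ` of the plane is the flux of the tiling `t`: the height function of `t` is
`L`-quasiperiodic with increments `4 ⟨φ, v⟩`. -/
def HasFlux (t : Tiling L) (φ : ℝ × ℝ) : Prop :=
  ∃ h : ℤ × ℤ → ℤ, IsHeightFunction t h ∧
    ∀ v ∈ L, ∀ u : ℤ × ℤ, ((h (u + v) - h u : ℤ) : ℝ) = 4 * pairing φ v

/-- The set of all fluxes of tilings of the torus `ℝ² / L`. -/
def fluxSet (L : AddSubgroup (ℤ × ℤ)) : Set (ℝ × ℝ) := {φ | ∃ t : Tiling L, HasFlux t φ}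

/-- An enumeration of the black squares and of the white squares of a fundamental domain
of `L`. -/
structure SquareEnumeration (L : AddSubgroup (ℤ × ℤ)) (n : ℕ) where
  black : Fin n → ℤ × ℤ
  white : Fin n → ℤ × ℤ
  isBlack_black : ∀ i, IsBlack (black i)
  not_isBlack_white : ∀ i, ¬ IsBlack (white i)
  existsUnique_black : ∀ s, IsBlack s → ∃! i, s - black i ∈ L
  existsUnique_white : ∀ s, ¬ IsBlack s → ∃! i, s - white i ∈ L

theorem Tiling.not_isBlack_partner (t : Tiling L) {s : ℤ × ℤ} (hs : IsBlack s) :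
    ¬ IsBlack (t.partner s) := by
  unfold IsBlack at *
  rcases t.adjacent s with h | h | h | h <;> rw [h] <;>
    simp only [Prod.fst_add, Prod.snd_add, Prod.fst_sub, Prod.snd_sub, Int.even_iff] at * <;>
    omega

variable {n : ℕ}

/-- The index of the white square that `t` matches, modulo `L`, with the `i`-th black square. -/
noncomputable def SquareEnumeration.matchIndex (E : SquareEnumeration L n) (t : Tiling L)
    (i : Fin n) : Fin n :=
  (E.existsUnique_white _ (t.not_isBlack_partner (E.isBlack_black i))).choose

theorem SquareEnumeration.matchIndex_spec (E : SquareEnumeration L n) (t : Tiling L)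
    (i : Fin n) : t.partner (E.black i) - E.white (E.matchIndex t i) ∈ L :=
  (E.existsUnique_white _ (t.not_isBlack_partner (E.isBlack_black i))).choose_spec.1

theorem SquareEnumeration.matchIndex_injective (E : SquareEnumeration L n) (t : Tiling L) :
    Function.Injective (E.matchIndex t) := by
  intro i j hij
  have hi := E.matchIndex_spec t i
  have hj := E.matchIndex_spec t j
  rw [hij] at hi
  have hd : t.partner (E.black i) - t.partner (E.black j) ∈ L := by
    have := L.sub_mem hi hj
    simpa using this
  have hp := t.periodic (t.partner (E.black j)) _ hd
  rw [add_sub_cancel, t.involutive, t.involutive] at hp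
  have hb : E.black i - E.black j ∈ L := by
    rw [hp, add_sub_cancel_left]
    exact hd
  exact (E.existsUnique_black _ (E.isBlack_black i)).unique
    (by rw [sub_self]; exact L.zero_mem) hb

/-- The permutation that the tiling `t` induces through the enumeration `E`. -/
noncomputable def SquareEnumeration.matchPerm (E : SquareEnumeration L n) (t : Tiling L) :
    Equiv.Perm (Fin n) :=
  Equiv.ofBijective (E.matchIndex t) (Finite.injective_iff_bijective.1 (E.matchIndex_injective t))

open Classical in
/-- The Kasteleyn sign of the edge of the dual graph joining the black square `b` to the adjacent
white square `w`: it is `-1` on the dominoes of the brick wall in which every black square is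
matched with the white square on its right, and `1` on all other edges. -/
noncomputable def edgeSign (b w : ℤ × ℤ) : ℤˣ := if w = b + (1, 0) then -1 else 1

/-- The sign of the term of the tiling `t` in the combinatorial expansion of the Kasteleyn
determinant of the torus: the sign of the permutation times the product of the Kasteleyn signs
of the dominoes. -/
noncomputable def SquareEnumeration.tilingSign (E : SquareEnumeration L n) (t : Tiling L) : ℤˣ :=
  Equiv.Perm.sign (E.matchPerm t) * ∏ i, edgeSign (E.black i) (t.partner (E.black i))

/-- A basis of `L^*` is flux-connecting if any two fluxes are joined by a sequence of fluxes in
which consecutive terms differ by plus or minus a basis vector. -/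
def IsFluxConnecting (L : AddSubgroup (ℤ × ℤ)) (v : Module.Basis (Fin 2) ℤ (dualLattice L)) :
    Prop :=
  ∀ φ ∈ fluxSet L, ∀ ψ ∈ fluxSet L, ∃ (m : ℕ) (f : ℕ → ℝ × ℝ), f 0 = φ ∧ f m = ψ ∧
    (∀ k ≤ m, f k ∈ fluxSet L) ∧
    ∀ k < m, ∃ i : Fin 2, f (k + 1) - f k = (v i : ℝ × ℝ) ∨ f (k + 1) - f k = -(v i : ℝ × ℝ)

/-- The points `φ` and `ψ` lie on one same line parallel to `u`. -/
def SameLine (u φ ψ : ℝ × ℝ) : Prop := ∃ r : ℝ, ψ = φ + r • u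

/-- `φ` and `φ'` are adjacent fluxes on a line parallel to `u`: distinct fluxes on that line
with no flux strictly between them. -/
def AdjacentFluxes (L : AddSubgroup (ℤ × ℤ)) (u φ φ' : ℝ × ℝ) : Prop :=
  φ ∈ fluxSet L ∧ φ' ∈ fluxSet L ∧ φ ≠ φ' ∧ SameLine u φ φ' ∧
    ∀ χ ∈ openSegment ℝ φ φ', χ ∉ fluxSet L

/-- The lines parallel to `u` through the fluxes `φ` and `ψ` are adjacent: they are distinct and
no line parallel to `u` strictly between them contains a flux. -/
def AdjacentLines (L : AddSubgroup (ℤ × ℤ)) (u φ ψ : ℝ × ℝ) : Prop :=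
  φ ∈ fluxSet L ∧ ψ ∈ fluxSet L ∧ ¬ SameLine u φ ψ ∧
    ∀ χ ∈ openSegment ℝ φ ψ, ∀ χ' ∈ fluxSet L, ¬ SameLine u χ χ'

end DominoTorus

/-! Write a tiling as its 0/1 indicator on the edges of the dual graph. Two tilings have heights
differing by `4 * k`, and their indicators differ by the divergence-free `flow k`. The sign exponent
of a tiling (inversions plus Kasteleyn edges) extends modulo 2 to a quadratic function
`signExponent` of all integer edge functions. By `signExponent_add` its polarisation against a
divergence-free function is a sum of terms local to the squares. Between two flows this sum is the
cup product of the differentials of the two height changes (`localPairing_flow`), so it depends only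
on their periods: it is `2n` times the determinant of the period vectors (`cupProduct_eq`).

Hence `signChange t k`, the change of the exponent when `4 * k` is added to the height, is additive
in `k` up to a cup product. It vanishes on the indicator of one vertex class: this is the Kasteleyn
condition, checked formally around a vertex. These indicators generate the periodic functions, so
`signChange` depends only on the periods of `k`. This proves that tilings with equal flux have equal
sign.

The torus has `2n` squares, so a basis of the dual lattice has determinant `±1/(2n)` and the cup
product becomes `±` the integer determinant of coordinates. A function modulo 2 with this
polarisation has the form `α x + β y + x y` (`exists_signChange_eq`). Up to a constant this is `(x +
β)(y + α)`: it is odd on exactly one of the four parity classes, which gives the odd-one-out sign,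
and its increment in `x` is `y + α`, which gives both statements on lines.

Adjacency must still be turned into coordinate steps `±1`. On a line this follows from convexity of
the flux set, obtained by rounding an interpolated height difference; for parallel lines it follows
from the flux-connecting property. -/

namespace DominoTorus

variable {L : AddSubgroup (ℤ × ℤ)} {n : ℕ}

/-! ### Directions, colours and heights as functions on dual edges -/

/-- The unit vectors pointing east, north, west and south. -/
def dir : Fin 4 → ℤ × ℤ := ![(1, 0), (0, 1), (-1, 0), (0, -1)]

theorem dir_add_two (d : Fin 4) : dir (d + 2) = -dir d := by
  fin_cases d <;> rfl

theorem dir_injective : Function.Injective dir := by decide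

open Classical in
/-- The colour of a square: `1` if it is black and `-1` if it is white. -/
noncomputable def colour (s : ℤ × ℤ) : ℤ := if IsBlack s then 1 else -1

theorem colour_mul_self (s : ℤ × ℤ) : colour s * colour s = 1 := by
  unfold colour; split_ifs <;> rfl

theorem colour_of_isBlack {s : ℤ × ℤ} (h : IsBlack s) : colour s = 1 := by simp [colour, h]

theorem colour_of_not_isBlack {s : ℤ × ℤ} (h : ¬ IsBlack s) : colour s = -1 := by simp [colour, h]

theorem isBlack_add_dir (s : ℤ × ℤ) (d : Fin 4) : IsBlack (s + dir d) ↔ ¬ IsBlack s := by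
  unfold IsBlack
  fin_cases d <;> simp [dir, Int.even_iff] <;> omega

theorem isBlack_add {s w : ℤ × ℤ} (h : Even (w.1 + w.2)) : IsBlack (s + w) ↔ IsBlack s := by
  unfold IsBlack
  simp only [Prod.fst_add, Prod.snd_add, Int.even_iff] at *
  omega

theorem colour_add_dir (s : ℤ × ℤ) (d : Fin 4) : colour (s + dir d) = -colour s := by
  by_cases h : IsBlack s
  · rw [colour_of_isBlack h, colour_of_not_isBlack]
    rw [isBlack_add_dir]; simpa
  · rw [colour_of_not_isBlack h, colour_of_isBlack, neg_neg]
    rwa [isBlack_add_dir]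

theorem colour_add {s w : ℤ × ℤ} (h : Even (w.1 + w.2)) : colour (s + w) = colour s := by
  by_cases hs : IsBlack s
  · rw [colour_of_isBlack hs, colour_of_isBlack ((isBlack_add h).2 hs)]
  · rw [colour_of_not_isBlack hs, colour_of_not_isBlack (mt (isBlack_add h).1 hs)]

theorem IsValidLattice.even (hL : IsValidLattice L) {w : ℤ × ℤ} (hw : w ∈ L) :
    Even (w.1 + w.2) := by
  obtain ⟨v₀, v₁, rfl, -, h₀, h₁⟩ := hL
  refine AddSubgroup.closure_induction (p := fun w _ => Even (w.1 + w.2)) ?_ (by simp) ?_ ?_ hw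
  · rintro x (rfl | rfl) <;> assumption
  · intro x y _ _ hx hy
    have := hx.add hy
    rwa [add_add_add_comm] at this
  · intro x _ hx
    have := hx.neg
    rwa [neg_add] at this

/-- The increments of `k` along the four sides of the square `s`, traversed counterclockwise. -/
def sideDiff {R : Type*} [AddCommGroup R] (k : ℤ × ℤ → R) (s : ℤ × ℤ) : Fin 4 → R :=
  ![k (s + (1, 1)) - k (s + (1, 0)), k (s + (0, 1)) - k (s + (1, 1)), k s - k (s + (0, 1)),
    k (s + (1, 0)) - k s]

theorem sideDiff_add_dir {R : Type*} [AddCommGroup R] (k : ℤ × ℤ → R) (s : ℤ × ℤ) (d : Fin 4) :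
    sideDiff k (s + dir d) (d + 2) = -sideDiff k s d := by
  have h0 : s + (0, 0) = s := add_zero s
  fin_cases d <;> simp [sideDiff, dir, add_assoc, h0]

theorem sum_sideDiff {R : Type*} [AddCommGroup R] (k : ℤ × ℤ → R) (s : ℤ × ℤ) :
    ∑ d, sideDiff k s d = 0 := by
  simp [sideDiff, Fin.sum_univ_four]

/-- The indicator of the dominoes of a tiling: it is `1` if the square `s` and its neighbour in
direction `d` form a domino. -/
def dominoInd (t : Tiling L) (s : ℤ × ℤ) (d : Fin 4) : ℤ :=
  if t.partner s = s + dir d then 1 else 0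

theorem partner_eq_iff (t : Tiling L) (s p : ℤ × ℤ) : t.partner s = p ↔ t.partner p = s := by
  constructor <;> rintro rfl <;> exact t.involutive _

theorem dominoInd_add_dir (t : Tiling L) (s : ℤ × ℤ) (d : Fin 4) :
    dominoInd t (s + dir d) (d + 2) = dominoInd t s d := by
  simp only [dominoInd, dir_add_two, add_neg_cancel_right]
  exact if_congr (partner_eq_iff _ _ _) rfl rfl

theorem exists_partner_eq (t : Tiling L) (s : ℤ × ℤ) : ∃ d, t.partner s = s + dir d := by
  rcases t.adjacent s with h | h | h | h
  · exact ⟨0, h⟩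
  · exact ⟨2, by rw [h]; rfl⟩
  · exact ⟨1, h⟩
  · exact ⟨3, by rw [h]; rfl⟩

theorem sum_dominoInd (t : Tiling L) (s : ℤ × ℤ) : ∑ d, dominoInd t s d = 1 := by
  obtain ⟨d, hd⟩ := exists_partner_eq t s
  unfold dominoInd
  simp [hd, dir_injective.eq_iff]

theorem dominoInd_add (t : Tiling L) (s : ℤ × ℤ) (d : Fin 4) {w : ℤ × ℤ} (hw : w ∈ L) :
    dominoInd t (s + w) d = dominoInd t s d := by
  simp only [dominoInd, t.periodic _ _ hw, add_right_comm s w, add_left_inj]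

theorem heightStep_eq (t : Tiling L) (s : ℤ × ℤ) (d : Fin 4) :
    heightStep t s (s + dir d) = colour s * (1 - 4 * dominoInd t s d) := by
  unfold heightStep colour dominoInd
  split_ifs <;> rfl

/-- The definition controls the west and north sides of each square. The east and south sides are
the west and north sides of neighbours, where colour and side increment both change sign. -/
theorem isHeightFunction_iff (t : Tiling L) (h : ℤ × ℤ → ℤ) :
    IsHeightFunction t h ↔
      h 0 = 0 ∧ ∀ s d, colour s * sideDiff h s d = 4 * dominoInd t s d - 1 := by
  have key : ∀ s d, (colour s * sideDiff h s d = 4 * dominoInd t s d - 1 ↔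
      -sideDiff h s d = heightStep t s (s + dir d)) := by
    intro s d
    rw [heightStep_eq]
    unfold colour
    split_ifs <;> constructor <;> intro h <;> linarith
  have symm : ∀ s d, colour s * sideDiff h s d = 4 * dominoInd t s d - 1 ↔
      colour (s + dir d) * sideDiff h (s + dir d) (d + 2) =
        4 * dominoInd t (s + dir d) (d + 2) - 1 := by
    intro s d
    rw [colour_add_dir, sideDiff_add_dir, dominoInd_add_dir, neg_mul_neg]
  have hW : ∀ x y, h (x, y + 1) - h (x, y) = heightStep t (x, y) (x - 1, y) ↔
      colour (x, y) * sideDiff h (x, y) 2 = 4 * dominoInd t (x, y) 2 - 1 := by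
    intro x y
    rw [key]
    simp [sideDiff, dir, sub_eq_add_neg]
  have hN : ∀ x y, h (x + 1, y) - h (x, y) = heightStep t (x, y - 1) (x, y) ↔
      colour (x, y - 1) * sideDiff h (x, y - 1) 1 = 4 * dominoInd t (x, y - 1) 1 - 1 := by
    intro x y
    rw [key]
    simp [sideDiff, dir]
  unfold IsHeightFunction
  refine and_congr_right fun _ => ?_
  simp only [hW, hN]
  constructor
  · rintro ⟨h2, h1⟩ ⟨x, y⟩ d
    have h1' : ∀ x y, colour (x, y) * sideDiff h (x, y) 1 = 4 * dominoInd t (x, y) 1 - 1 := by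
      intro x y
      have := h1 x (y + 1)
      rwa [add_sub_cancel_right] at this
    fin_cases d
    · exact (symm _ 0).2 (h2 _ _)
    · exact h1' _ _
    · exact h2 _ _
    · exact (symm _ 3).2 (h1' _ _)
  · intro hall
    exact ⟨fun x y => hall _ _, fun x y => hall _ _⟩

theorem exists_tiling_of_sideDiff (hL : IsValidLattice L) (h : ℤ × ℤ → ℤ) (φ : ℝ × ℝ)
    (h0 : h 0 = 0)
    (hstep : ∀ s d, colour s * sideDiff h s d = -1 ∨ colour s * sideDiff h s d = 3)
    (hper : ∀ v ∈ L, ∀ u : ℤ × ℤ, ((h (u + v) - h u : ℤ) : ℝ) = 4 * pairing φ v) :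
    ∃ t : Tiling L, HasFlux t φ := by
  -- Four values in `{-1, 3}` with sum zero include exactly one `3`, which marks the side crossed by
  -- the domino.
  have hex : ∀ s, ∃! d, colour s * sideDiff h s d = 3 := by
    intro s
    have hsum : ∑ d, colour s * sideDiff h s d = 0 := by
      rw [← Finset.mul_sum, sum_sideDiff, mul_zero]
    rw [Fin.sum_univ_four] at hsum
    have e := fun d => hstep s d
    generalize (fun d => colour s * sideDiff h s d) = f at *
    have e0 := e 0
    have e1 := e 1
    have e2 := e 2
    have e3 := e 3
    refine existsUnique_of_exists_of_unique ?_ ?_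
    · by_contra! hne
      have := hne 0; have := hne 1; have := hne 2; have := hne 3
      omega
    · intro a b ha hb
      fin_cases a <;> fin_cases b <;> first | rfl | (simp at ha hb; omega)
  choose D hD hDu using hex
  have hDsymm : ∀ s, D (s + dir (D s)) = D s + 2 := by
    intro s
    symm
    apply hDu
    rw [colour_add_dir, sideDiff_add_dir, neg_mul_neg, hD]
  have hdiff : ∀ v ∈ L, ∀ u u' : ℤ × ℤ, h (u + v) - h (u' + v) = h u - h u' := by
    intro v hv u u'
    have h1 := hper v hv u
    have h2 := hper v hv u'
    rw [← h2] at h1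
    have := Int.cast_injective h1
    linarith
  have hDper : ∀ s, ∀ v ∈ L, D (s + v) = D s := by
    intro s v hv
    symm
    apply hDu
    have : sideDiff h (s + v) = sideDiff h s := by
      unfold sideDiff
      simp only [add_right_comm s v, hdiff v hv]
    rw [this, colour_add (hL.even hv), hD]
  refine ⟨⟨fun s => s + dir (D s), ?_, ?_, ?_⟩, h, ?_, hper⟩
  · intro s
    unfold AreAdjacent
    have : ∀ d : Fin 4, s + dir d = s + (1, 0) ∨ s + dir d = s - (1, 0) ∨ s + dir d = s + (0, 1) ∨
      s + dir d = s - (0, 1) := by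
      intro d
      fin_cases d <;> simp [dir, sub_eq_add_neg]
    exact this _
  · intro s
    rw [hDsymm, dir_add_two, add_neg_cancel_right]
  · intro s v hv
    rw [hDper s v hv, add_right_comm]
  · rw [isHeightFunction_iff]
    refine ⟨h0, fun s d => ?_⟩
    simp only [dominoInd, add_right_inj, dir_injective.eq_iff]
    split_ifs with hd
    · rw [← hd, hD]; rfl
    · rcases hstep s d with h' | h'
      · rw [h']; rfl
      · exact absurd (hDu s d h').symm hd

/-! ### Summation over the torus -/

section TorusSum

variable {R : Type*} [AddCommGroup R]

/-- The function `f` on the square lattice is invariant under translations by `L`. -/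
def IsPeriodic {X : Type*} (L : AddSubgroup (ℤ × ℤ)) (f : ℤ × ℤ → X) : Prop :=
  ∀ s, ∀ w ∈ L, f (s + w) = f s

theorem IsPeriodic.eq_of_sub_mem {X : Type*} {f : ℤ × ℤ → X} (hf : IsPeriodic L f) {s p : ℤ × ℤ}
    (h : s - p ∈ L) : f s = f p := by
  rw [← hf p _ h, add_sub_cancel]

theorem IsPeriodic.shift {X : Type*} {f : ℤ × ℤ → X} (hf : IsPeriodic L f) (a : ℤ × ℤ) :
    IsPeriodic L (fun s => f (s + a)) := by
  intro s w hw
  simp only [add_right_comm s w a, hf _ w hw]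

/-- The index of the white square in direction `d` of the `i`-th black square. -/
noncomputable def SquareEnumeration.stepIndex (E : SquareEnumeration L n) (d : Fin 4)
    (i : Fin n) : Fin n :=
  (E.existsUnique_white (E.black i + dir d)
    (by rw [isBlack_add_dir, not_not]; exact E.isBlack_black i)).choose

theorem SquareEnumeration.stepIndex_spec (E : SquareEnumeration L n) (d : Fin 4) (i : Fin n) :
    E.black i + dir d - E.white (E.stepIndex d i) ∈ L :=
  (E.existsUnique_white (E.black i + dir d)
    (by rw [isBlack_add_dir, not_not]; exact E.isBlack_black i)).choose_spec.1

theorem SquareEnumeration.black_index_unique (E : SquareEnumeration L n) {i j : Fin n}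
    (h : E.black i - E.black j ∈ L) : i = j :=
  (E.existsUnique_black _ (E.isBlack_black i)).unique (by rw [sub_self]; exact L.zero_mem) h

theorem SquareEnumeration.white_index_unique (E : SquareEnumeration L n) {s : ℤ × ℤ} {i j : Fin n}
    (hi : s - E.white i ∈ L) (hj : s - E.white j ∈ L) : i = j := by
  have h : E.white i - E.white j ∈ L := by
    have := L.sub_mem hj hi
    simpa using this
  exact (E.existsUnique_white _ (E.not_isBlack_white i)).unique
    (by rw [sub_self]; exact L.zero_mem) h

theorem SquareEnumeration.stepIndex_injective (E : SquareEnumeration L n) (d : Fin 4) :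
    Function.Injective (E.stepIndex d) := by
  intro i j hij
  have hi := E.stepIndex_spec d i
  have hj := E.stepIndex_spec d j
  rw [hij] at hi
  apply E.black_index_unique
  have := L.sub_mem hi hj
  simpa using this

/-- The permutation of the indices that is induced by moving one step in direction `d`. -/
noncomputable def SquareEnumeration.stepPerm (E : SquareEnumeration L n) (d : Fin 4) :
    Equiv.Perm (Fin n) :=
  Equiv.ofBijective (E.stepIndex d) (Finite.injective_iff_bijective.1 (E.stepIndex_injective d))

theorem SquareEnumeration.stepPerm_spec (E : SquareEnumeration L n) (d : Fin 4) (i : Fin n) :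
    E.black i + dir d - E.white (E.stepPerm d i) ∈ L :=
  E.stepIndex_spec d i

/-- The sum of a periodic function over all squares, or over all vertices, of the torus. -/
def SquareEnumeration.torusSum (E : SquareEnumeration L n) (f : ℤ × ℤ → R) : R :=
  ∑ i, f (E.black i) + ∑ j, f (E.white j)

theorem SquareEnumeration.sum_white (E : SquareEnumeration L n) {f : ℤ × ℤ → R}
    (hf : IsPeriodic L f) (d : Fin 4) : ∑ j, f (E.white j) = ∑ i, f (E.black i + dir d) := by
  rw [← Equiv.sum_comp (E.stepPerm d)]
  exact Finset.sum_congr rfl fun i _ => (hf.eq_of_sub_mem (E.stepPerm_spec d i)).symm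

theorem SquareEnumeration.sum_black (E : SquareEnumeration L n) {f : ℤ × ℤ → R}
    (hf : IsPeriodic L f) (d : Fin 4) : ∑ i, f (E.black i) = ∑ j, f (E.white j + dir d) := by
  rw [E.sum_white (hf.shift (dir d)) (d + 2)]
  simp [dir_add_two]

theorem SquareEnumeration.torusSum_shift (E : SquareEnumeration L n) {f : ℤ × ℤ → R}
    (hf : IsPeriodic L f) (d : Fin 4) : E.torusSum (fun s => f (s + dir d)) = E.torusSum f := by
  unfold torusSum
  rw [← E.sum_white hf d, ← E.sum_black hf d, add_comm]

theorem SquareEnumeration.torusSum_add (E : SquareEnumeration L n) (f g : ℤ × ℤ → R) :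
    E.torusSum (fun s => f s + g s) = E.torusSum f + E.torusSum g := by
  simp only [torusSum, Finset.sum_add_distrib]
  abel

theorem SquareEnumeration.torusSum_zero (E : SquareEnumeration L n) :
    E.torusSum (fun _ => (0 : R)) = 0 := by
  simp [torusSum]

/-- A function on the edges of the dual graph of the torus, given at each square and direction. -/
structure IsEdgeFunction (L : AddSubgroup (ℤ × ℤ)) (F : ℤ × ℤ → Fin 4 → R) : Prop where
  periodic : IsPeriodic L F
  symm : ∀ s d, F (s + dir d) (d + 2) = F s d

/-- Every dual edge has one black end, and it is also the west or south edge of exactly one square.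
-/
theorem SquareEnumeration.sum_edges (E : SquareEnumeration L n) {F : ℤ × ℤ → Fin 4 → R}
    (hF : IsEdgeFunction L F) :
    ∑ i, ∑ d, F (E.black i) d = E.torusSum (fun s => F s 2 + F s 3) := by
  have hp : ∀ d, IsPeriodic L (fun s => F s d) := fun d s w hw => by
    simp only [hF.periodic s w hw]
  have h0 := E.sum_white (hp 2) 0
  have h1 := E.sum_white (hp 3) 1
  have e0 : ∀ s, F (s + dir 0) 2 = F s 0 := fun s => hF.symm s 0
  have e1 : ∀ s, F (s + dir 1) 3 = F s 1 := fun s => hF.symm s 1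
  simp only [e0] at h0
  simp only [e1] at h1
  unfold torusSum
  simp only [Fin.sum_univ_four, Finset.sum_add_distrib, h0, h1]
  abel

end TorusSum

/-! ### Inversion counts as quadratic forms modulo 2 -/

section Orders

/-- The position of an index and a direction in the lexicographic order. -/
def lexCode (e : Fin n × Fin 4) : ℕ := 4 * e.1 + e.2

theorem lexCode_injective : Function.Injective (lexCode (n := n)) := by
  rintro ⟨i, d⟩ ⟨j, e⟩ h
  simp only [lexCode] at h
  have := d.2; have := e.2
  ext <;> simp only <;> omega

/-- Squares of smaller index contribute complete stars, which sum to zero, so only the square of `f`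
itself remains. This is what makes the polarisation local. -/
theorem sum_lexCode_lt (x : Fin n × Fin 4 → ZMod 2) (hx : ∀ i, ∑ d, x (i, d) = 0)
    (f : Fin n × Fin 4) :
    ∑ e, (if lexCode e < lexCode f then x e else 0) =
      ∑ d, if d < f.2 then x (f.1, d) else 0 := by
  obtain ⟨k, c⟩ := f
  rw [Fintype.sum_prod_type, Finset.sum_eq_single k]
  · refine Finset.sum_congr rfl fun d _ => if_congr ?_ rfl rfl
    simp only [lexCode, Fin.lt_def]
    omega
  · intro i _ hik
    have hne : (i : ℕ) ≠ k := fun h => hik (Fin.ext h)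
    have := c.2
    rcases lt_or_gt_of_ne hne with h | h
    · rw [← hx i]
      refine Finset.sum_congr rfl fun d _ => if_pos ?_
      have := d.2
      simp only [lexCode]
      omega
    · refine Finset.sum_eq_zero fun d _ => if_neg ?_
      have := d.2
      simp only [lexCode]
      omega
  · simp

/-- The quadratic form that sums over the pairs of elements that are in opposite order for the
keys `a` and `b`. -/
def inversionForm {ι : Type*} [Fintype ι] (a b : ι → ℕ) (x : ι → ℤ) : ℤ :=
  ∑ e, ∑ f, if a e < a f ∧ b f < b e then x e * x f else 0

/-- For `e ≠ f`, being in opposite order for the two keys is, modulo 2, the sum of the two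
indicators of `e` preceding `f`. The cross term thus splits into one part for each key. -/
theorem inversionForm_add {ι : Type*} [Fintype ι] {a b : ι → ℕ} (ha : Function.Injective a)
    (hb : Function.Injective b) (x y : ι → ℤ) :
    (inversionForm a b (x + y) : ZMod 2) = inversionForm a b x + inversionForm a b y +
      ∑ f, (x f : ZMod 2) * (∑ e, (if a e < a f then (y e : ZMod 2) else 0) +
        ∑ e, (if b e < b f then (y e : ZMod 2) else 0)) := by
  have h1 : inversionForm a b (x + y) = inversionForm a b x + inversionForm a b y +
      ((∑ e, ∑ f, if a e < a f ∧ b f < b e then x f * y e else 0) +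
        ∑ e, ∑ f, if a f < a e ∧ b e < b f then x f * y e else 0) := by
    rw [Finset.sum_comm (f := fun e f => if a f < a e ∧ b e < b f then x f * y e else 0)]
    simp only [inversionForm, ← Finset.sum_add_distrib]
    refine Finset.sum_congr rfl fun e _ => Finset.sum_congr rfl fun f _ => ?_
    simp only [Pi.add_apply]
    split_ifs <;> ring
  have h2 : ∀ e f, ((if a e < a f ∧ b f < b e then x f * y e else 0 : ℤ) : ZMod 2) +
      ((if a f < a e ∧ b e < b f then x f * y e else 0 : ℤ) : ZMod 2) =
      x f * ((if a e < a f then (y e : ZMod 2) else 0) + if b e < b f then (y e : ZMod 2) else 0) := by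
    intro e f
    have two : ∀ z : ZMod 2, z + z = 0 := CharTwo.add_self_eq_zero
    by_cases hef : e = f
    · subst hef; simp
    · rcases lt_or_gt_of_ne (ha.ne hef) with h | h <;>
      rcases lt_or_gt_of_ne (hb.ne hef) with h' | h' <;>
      simp [h, h', h.not_gt, h'.not_gt, two]
  rw [h1]
  push_cast at h2 ⊢
  congr 1
  simp only [← Finset.sum_add_distrib, Finset.mul_sum, h2]
  rw [Finset.sum_comm]

end Orders

/-! ### The quadratic extension of the sign exponent -/

/-- An edge of the dual graph, seen from its black square, is sent to the same edge seen from its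
white square. -/
noncomputable def SquareEnumeration.edgeEquiv (E : SquareEnumeration L n) :
    Fin n × Fin 4 ≃ Fin n × Fin 4 where
  toFun e := (E.stepPerm e.2 e.1, e.2 + 2)
  invFun e := ((E.stepPerm (e.2 + 2)).symm e.1, e.2 + 2)
  left_inv e := by
    have h : e.2 + 2 + 2 = e.2 := by rw [add_assoc]; exact add_zero _
    simp [h]
  right_inv e := by
    have h : e.2 + 2 + 2 = e.2 := by rw [add_assoc]; exact add_zero _
    simp [h]

theorem IsEdgeFunction.apply_white {R : Type*} {F : ℤ × ℤ → Fin 4 → R}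
    (hF : IsEdgeFunction L F) (E : SquareEnumeration L n) (e : Fin n × Fin 4) :
    F (E.white (E.edgeEquiv e).1) (E.edgeEquiv e).2 = F (E.black e.1) e.2 := by
  rw [← hF.symm (E.black e.1) e.2, hF.periodic.eq_of_sub_mem (E.stepPerm_spec e.2 e.1)]
  rfl

/-- The triangular number `a (a - 1) / 2`. -/
def triangle (a : ℤ) : ℤ := a * (a - 1) / 2

theorem triangle_add (a b : ℤ) : triangle (a + b) = triangle a + triangle b + a * b := by
  have h : ∀ a : ℤ, 2 * triangle a = a * (a - 1) := fun a =>
    Int.mul_ediv_cancel' (Int.even_mul_pred_self a).two_dvd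
  have h1 := h (a + b)
  have h2 := h a
  have h3 := h b
  have : 2 * triangle (a + b) = 2 * (triangle a + triangle b + a * b) := by
    rw [h1, mul_add, mul_add, h2, h3]; ring
  linarith

/-- The exponent of the Kasteleyn sign, extended to all integer functions on the edges. -/
noncomputable def SquareEnumeration.signExponent (E : SquareEnumeration L n)
    (F : ℤ × ℤ → Fin 4 → ℤ) : ℤ :=
  inversionForm lexCode (lexCode ∘ E.edgeEquiv) (fun e => F (E.black e.1) e.2) +
    ∑ i, ∑ d, triangle (F (E.black i) d) + ∑ i, F (E.black i) 0

/-- The sum of the products `x c * y d` over `c < d`. -/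
def orderedProduct {R : Type*} [CommRing R] (x y : Fin 4 → R) : R :=
  x 0 * y 1 + (x 0 + x 1) * y 2 + (x 0 + x 1 + x 2) * y 3

/-- The contribution of a square to the intersection number of two functions on the edges. -/
def localPairing {R : Type*} [CommRing R] (x y : Fin 4 → R) : R :=
  orderedProduct x y + (x 2 * y 2 + x 3 * y 3)

theorem sum_mul_sum_lexCode_lt (x y : Fin n × Fin 4 → ℤ) (hx : ∀ i, ∑ d, x (i, d) = 0) :
    ∑ f, (y f : ZMod 2) * ∑ e, (if lexCode e < lexCode f then (x e : ZMod 2) else 0) =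
      ∑ i, ((orderedProduct (fun d => x (i, d)) (fun d => y (i, d)) : ℤ) : ZMod 2) := by
  have hx' : ∀ i, ∑ d, ((x (i, d) : ℤ) : ZMod 2) = 0 := fun i => by
    have := congrArg (Int.cast (R := ZMod 2)) (hx i)
    simpa using this
  simp only [sum_lexCode_lt (fun e => (x e : ZMod 2)) hx']
  rw [Fintype.sum_prod_type]
  refine Finset.sum_congr rfl fun i _ => ?_
  simp only [Fin.sum_univ_four, orderedProduct]
  simp [Fin.lt_def]
  ring

/-- The inversion form, ordered at the black and at the white ends, contributes an ordered product
at every square. The triangular numbers contribute the product `M * D` on every edge, and the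
Kasteleyn term is linear. -/
theorem SquareEnumeration.signExponent_add (E : SquareEnumeration L n)
    {M D : ℤ × ℤ → Fin 4 → ℤ} (hM : IsEdgeFunction L M) (hD : IsEdgeFunction L D)
    (hdiv : ∀ s, ∑ d, D s d = 0) :
    (E.signExponent (M + D) : ZMod 2) = E.signExponent M + E.signExponent D +
      (E.torusSum fun s => localPairing (D s) (M s) : ℤ) := by
  have hinj : Function.Injective (lexCode ∘ E.edgeEquiv) :=
    lexCode_injective.comp E.edgeEquiv.injective
  have h1 := inversionForm_add lexCode_injective hinj
    (fun e => M (E.black e.1) e.2) (fun e => D (E.black e.1) e.2)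
  have hw : ∑ f, ((M (E.black (Prod.fst f)) f.2 : ℤ) : ZMod 2) *
      ∑ e, (if (lexCode ∘ E.edgeEquiv) e < (lexCode ∘ E.edgeEquiv) f then
        ((D (E.black (Prod.fst e)) e.2 : ℤ) : ZMod 2) else 0) =
      ∑ j, ((orderedProduct (D (E.white j)) (M (E.white j)) : ℤ) : ZMod 2) := by
    rw [← sum_mul_sum_lexCode_lt (fun e => D (E.white e.1) e.2) (fun e => M (E.white e.1) e.2)
      (fun i => hdiv _)]
    refine Eq.trans (Finset.sum_congr rfl fun f _ => ?_) (Equiv.sum_comp E.edgeEquiv _)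
    rw [hM.apply_white]
    congr 1
    refine Eq.trans (Finset.sum_congr rfl fun e _ => ?_) (Equiv.sum_comp E.edgeEquiv _)
    simp only [hD.apply_white, Function.comp]
  simp only [mul_add, Finset.sum_add_distrib] at h1
  rw [hw, sum_mul_sum_lexCode_lt (fun e => D (E.black e.1) e.2) (fun e => M (E.black e.1) e.2)
      (fun i => hdiv _)] at h1
  -- The edge products coming from `triangle_add` are charged to the west and south edges of
  -- squares, as in `localPairing`.
  have h2 := E.sum_edges (F := fun s d => M s d * D s d)
    ⟨fun s w hw => by simp only [hM.periodic s w hw, hD.periodic s w hw],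
      fun s d => by rw [hM.symm, hD.symm]⟩
  have h2' := congrArg (Int.cast (R := ZMod 2)) h2
  have h3 : (fun e => (M + D) (E.black (Prod.fst e)) e.2) =
    (fun e => M (E.black (Prod.fst e)) e.2) + fun e => D (E.black (Prod.fst e)) e.2 := rfl
  unfold signExponent
  rw [h3]
  push_cast
  rw [h1]
  simp only [Pi.add_apply, triangle_add, Finset.sum_add_distrib, torusSum, localPairing] at h2' ⊢
  push_cast at h2' ⊢
  simp only [Finset.sum_add_distrib, mul_comm (D _ _ : ZMod 2) (M _ _ : ZMod 2)] at h2' ⊢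
  linear_combination h2'

/-! ### Quasiperiodic functions and their intersection number -/

/-- The translations by `L` change `k` by constants. -/
def IsQuasiperiodic {R : Type*} [AddCommGroup R] (L : AddSubgroup (ℤ × ℤ)) (k : ℤ × ℤ → R) :
    Prop :=
  ∀ w ∈ L, ∃ c, ∀ u, k (u + w) = k u + c

theorem IsPeriodic.isQuasiperiodic {R : Type*} [AddCommGroup R] {k : ℤ × ℤ → R}
    (hk : IsPeriodic L k) : IsQuasiperiodic L k :=
  fun w hw => ⟨0, fun u => by rw [hk u w hw, add_zero]⟩

theorem IsQuasiperiodic.add {R : Type*} [AddCommGroup R] {k k' : ℤ × ℤ → R}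
    (hk : IsQuasiperiodic L k) (hk' : IsQuasiperiodic L k') : IsQuasiperiodic L (k + k') := by
  intro w hw
  obtain ⟨c, hc⟩ := hk w hw
  obtain ⟨c', hc'⟩ := hk' w hw
  exact ⟨c + c', fun u => by simp only [Pi.add_apply, hc, hc']; abel⟩

theorem IsQuasiperiodic.sub_eq {R : Type*} [AddCommGroup R] {k : ℤ × ℤ → R}
    (hk : IsQuasiperiodic L k) {w : ℤ × ℤ} (hw : w ∈ L) (u u' : ℤ × ℤ) :
    k (u + w) - k (u' + w) = k u - k u' := by
  obtain ⟨c, hc⟩ := hk w hw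
  rw [hc, hc]; abel

theorem SquareEnumeration.torusSum_shift_right {R : Type*} [AddCommGroup R]
    (E : SquareEnumeration L n) {f : ℤ × ℤ → R} (hf : IsPeriodic L f) :
    E.torusSum (fun s => f (s + (1, 0))) = E.torusSum f :=
  E.torusSum_shift hf 0

theorem SquareEnumeration.torusSum_shift_up {R : Type*} [AddCommGroup R]
    (E : SquareEnumeration L n) {f : ℤ × ℤ → R} (hf : IsPeriodic L f) :
    E.torusSum (fun s => f (s + (0, 1))) = E.torusSum f :=
  E.torusSum_shift hf 1

theorem SquareEnumeration.torusSum_shift_diag {R : Type*} [AddCommGroup R]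
    (E : SquareEnumeration L n) {f : ℤ × ℤ → R} (hf : IsPeriodic L f) :
    E.torusSum (fun s => f (s + (1, 1))) = E.torusSum f := by
  rw [← E.torusSum_shift_right hf, ← E.torusSum_shift_up (hf.shift (1, 0))]
  simp [add_assoc]

section Cross

variable {R : Type*} [CommRing R]

/-- The local term of the cup product of the differentials of two functions on the vertices. -/
def cupTerm (k p : ℤ × ℤ → R) (s : ℤ × ℤ) : R :=
  (k (s + (1, 1)) - k (s + (1, 0))) * (p (s + (0, 1)) - p (s + (1, 1))) +
    (k s - k (s + (1, 0))) * (p s - p (s + (0, 1)))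

/-- The intersection number of two quasiperiodic functions on the vertices. -/
def SquareEnumeration.cupProduct (E : SquareEnumeration L n) (k p : ℤ × ℤ → R) : R :=
  E.torusSum (cupTerm k p)

theorem SquareEnumeration.cupProduct_add_left (E : SquareEnumeration L n) (k k' p : ℤ × ℤ → R) :
    E.cupProduct (k + k') p = E.cupProduct k p + E.cupProduct k' p := by
  unfold cupProduct
  rw [← E.torusSum_add]
  congr 1; ext s; simp only [cupTerm, Pi.add_apply]; ring

theorem SquareEnumeration.cupProduct_add_right (E : SquareEnumeration L n) (k p p' : ℤ × ℤ → R) :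
    E.cupProduct k (p + p') = E.cupProduct k p + E.cupProduct k p' := by
  unfold cupProduct
  rw [← E.torusSum_add]
  congr 1; ext s; simp only [cupTerm, Pi.add_apply]; ring

/-- Summation by parts: differences of `k` are periodic, so the terms can be shifted until all of
them carry the factor `p s`. The differences of `k` multiplying it then telescope to zero. -/
theorem SquareEnumeration.cupProduct_periodic_right (E : SquareEnumeration L n)
    {k p : ℤ × ℤ → R} (hk : IsQuasiperiodic L k) (hp : IsPeriodic L p) :
    E.cupProduct k p = 0 := by
  have per : ∀ a b : ℤ × ℤ, IsPeriodic L fun s => p s * (k (s + a) - k (s + b)) := by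
    intro a b s w hw
    simp only [hp s w hw, add_right_comm s w, hk.sub_eq hw]
  have h1 := E.torusSum_shift_diag (per (0, -1) 0)
  have h2 := E.torusSum_shift_up (per (1, 0) (0, -1))
  have h3 : E.cupProduct k p = E.torusSum (fun s => p (s + (1, 1)) *
      (k (s + (1, 1) + (0, -1)) - k (s + (1, 1) + 0))) +
      E.torusSum (fun s => p (s + (0, 1)) * (k (s + (0, 1) + (1, 0)) - k (s + (0, 1) + (0, -1)))) +
      E.torusSum (fun s => p s * (k (s + 0) - k (s + (1, 0)))) := by
    rw [← E.torusSum_add, ← E.torusSum_add]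
    have h0 : ∀ s : ℤ × ℤ, s + (0, 0) = s := add_zero
    unfold cupProduct
    congr 1; ext s
    simp only [cupTerm, add_assoc, Prod.mk_add_mk, add_zero]
    norm_num [h0]
    ring
  rw [h3, h1, h2, ← E.torusSum_add, ← E.torusSum_add]
  refine (congrArg E.torusSum ?_).trans E.torusSum_zero
  ext s; ring

theorem SquareEnumeration.cupProduct_periodic_left (E : SquareEnumeration L n)
    {k p : ℤ × ℤ → R} (hk : IsQuasiperiodic L k) (hp : IsPeriodic L p) :
    E.cupProduct p k = 0 := by
  have per : ∀ a b : ℤ × ℤ, IsPeriodic L fun s => p s * (k (s + a) - k (s + b)) := by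
    intro a b s w hw
    simp only [hp s w hw, add_right_comm s w, hk.sub_eq hw]
  have h1 := E.torusSum_shift_diag (per (-1, 0) 0)
  have h2 := E.torusSum_shift_right (per (0, 1) (-1, 0))
  have h3 : E.cupProduct p k = E.torusSum (fun s => p (s + (1, 1)) *
      (k (s + (1, 1) + (-1, 0)) - k (s + (1, 1) + 0))) +
      E.torusSum (fun s => p (s + (1, 0)) * (k (s + (1, 0) + (0, 1)) - k (s + (1, 0) + (-1, 0)))) +
      E.torusSum (fun s => p s * (k (s + 0) - k (s + (0, 1)))) := by
    rw [← E.torusSum_add, ← E.torusSum_add]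
    have h0 : ∀ s : ℤ × ℤ, s + (0, 0) = s := add_zero
    unfold cupProduct
    congr 1; ext s
    simp only [cupTerm, add_assoc, Prod.mk_add_mk, add_zero]
    norm_num [h0]
    ring
  rw [h3, h1, h2, ← E.torusSum_add, ← E.torusSum_add]
  refine (congrArg E.torusSum ?_).trans E.torusSum_zero
  ext s; ring

end Cross

theorem pairing_add (φ : ℝ × ℝ) (u w : ℤ × ℤ) : pairing φ (u + w) = pairing φ u + pairing φ w := by
  simp only [pairing, Prod.fst_add, Prod.snd_add]; push_cast; ring

theorem add_pairing (φ ψ : ℝ × ℝ) (u : ℤ × ℤ) : pairing (φ + ψ) u = pairing φ u + pairing ψ u := by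
  simp only [pairing, Prod.fst_add, Prod.snd_add]; ring

/-- The increments of `k` along the vectors of `L` are given by the inner product with `φ`. -/
def HasPeriods (L : AddSubgroup (ℤ × ℤ)) (k : ℤ × ℤ → ℤ) (φ : ℝ × ℝ) : Prop :=
  ∀ w ∈ L, ∀ u, ((k (u + w) - k u : ℤ) : ℝ) = pairing φ w

theorem HasPeriods.isQuasiperiodic {k : ℤ × ℤ → ℤ} {φ : ℝ × ℝ} (hk : HasPeriods L k φ) :
    IsQuasiperiodic L k := by
  intro w hw
  refine ⟨k w - k 0, fun u => ?_⟩
  have h1 := hk w hw u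
  have h2 := hk w hw 0
  rw [← h2, zero_add] at h1
  have := Int.cast_injective h1
  linarith

theorem HasPeriods.add {k k' : ℤ × ℤ → ℤ} {φ φ' : ℝ × ℝ} (hk : HasPeriods L k φ)
    (hk' : HasPeriods L k' φ') : HasPeriods L (k + k') (φ + φ') := by
  intro w hw u
  rw [add_pairing, ← hk w hw u, ← hk' w hw u]
  simp only [Pi.add_apply]; push_cast; ring

/-- Over the reals each function is linear plus periodic, and the periodic parts do not contribute.
The linear parts give the same determinant at each of the `2n` squares. -/
theorem SquareEnumeration.cupProduct_eq (E : SquareEnumeration L n) {k k' : ℤ × ℤ → ℤ}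
    {φ φ' : ℝ × ℝ} (hk : HasPeriods L k φ) (hk' : HasPeriods L k' φ') :
    ((E.cupProduct k k' : ℤ) : ℝ) = 2 * n * (φ.1 * φ'.2 - φ.2 * φ'.1) := by
  have hcast : ((E.cupProduct k k' : ℤ) : ℝ) =
      E.cupProduct (fun u => (k u : ℝ)) (fun u => (k' u : ℝ)) := by
    simp [cupProduct, torusSum, cupTerm]
  have hlin : ∀ φ : ℝ × ℝ, IsQuasiperiodic L (pairing φ) := fun φ w _ =>
    ⟨pairing φ w, fun u => pairing_add _ _ _⟩
  have hper : ∀ {k : ℤ × ℤ → ℤ} {φ : ℝ × ℝ}, HasPeriods L k φ →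
      IsPeriodic L (fun u => (k u : ℝ) - pairing φ u) := by
    intro k φ hk s w hw
    have := hk w hw s
    push_cast at this
    simp only [pairing_add]
    linarith
  have hdec : ∀ (k : ℤ × ℤ → ℤ) (φ : ℝ × ℝ),
      (fun u => (k u : ℝ)) = pairing φ + fun u => (k u : ℝ) - pairing φ u := by
    intro k φ; ext u; simp
  rw [hcast, hdec k φ, E.cupProduct_add_left, hdec k' φ', E.cupProduct_add_right,
    E.cupProduct_periodic_right (hlin φ) (hper hk'),
    E.cupProduct_periodic_left ((hlin φ').add (hper hk').isQuasiperiodic) (hper hk)]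
  have : cupTerm (pairing φ) (pairing φ') = fun _ => φ.1 * φ'.2 - φ.2 * φ'.1 := by
    ext s
    simp only [cupTerm, pairing, Prod.fst_add, Prod.snd_add]
    push_cast; ring
  rw [cupProduct, this]
  simp [torusSum]
  ring

/-! ### Flows of height changes -/

/-- The change of the domino indicators when `4 k` is added to the height function. -/
noncomputable def flow (k : ℤ × ℤ → ℤ) (s : ℤ × ℤ) (d : Fin 4) : ℤ := colour s * sideDiff k s d

theorem isEdgeFunction_flow (hL : IsValidLattice L) {k : ℤ × ℤ → ℤ} (hk : IsQuasiperiodic L k) :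
    IsEdgeFunction L (flow k) := by
  refine ⟨fun s w hw => ?_, fun s d => ?_⟩
  · ext d
    have : sideDiff k (s + w) = sideDiff k s := by
      unfold sideDiff
      simp only [add_right_comm s w, hk.sub_eq hw]
    rw [flow, flow, colour_add (hL.even hw), this]
  · rw [flow, flow, colour_add_dir, sideDiff_add_dir, neg_mul_neg]

theorem sum_flow (k : ℤ × ℤ → ℤ) (s : ℤ × ℤ) : ∑ d, flow k s d = 0 := by
  simp only [flow]
  rw [← Finset.mul_sum, sum_sideDiff, mul_zero]

theorem flow_add (k k' : ℤ × ℤ → ℤ) : flow (k + k') = flow k + flow k' := by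
  ext s d
  simp only [flow, Pi.add_apply, ← mul_add]
  congr 1
  fin_cases d <;> simp [sideDiff] <;> ring

/-- The diagonal terms of `localPairing` complete the coefficients of `y 2` and `y 3` to `x 0 + x 1
+ x 2 = -x 3` and `0`. What remains is `x 0 * y 1 - x 3 * y 2`. -/
theorem localPairing_flow (k p : ℤ × ℤ → ℤ) (s : ℤ × ℤ) :
    localPairing (flow k s) (flow p s) = cupTerm k p s := by
  have h := colour_mul_self s
  simp only [localPairing, orderedProduct, flow, sideDiff, cupTerm]
  simp only [Matrix.cons_val]
  linear_combination ((k (s + (1, 1)) - k (s + (1, 0))) * (p (s + (0, 1)) - p (s + (1, 1))) +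
    (k s - k (s + (1, 0))) * (p s - p (s + (0, 1)))) * h

theorem isEdgeFunction_dominoInd (t : Tiling L) : IsEdgeFunction L (dominoInd t) :=
  ⟨fun s w hw => by ext d; exact dominoInd_add t s d hw, dominoInd_add_dir t⟩

theorem colour_cast (s : ℤ × ℤ) : (colour s : ZMod 2) = 1 := by
  unfold colour; split_ifs <;> decide

/-- After shifting two of the terms to the opposite ends of their edges, `p (s + (1, 0))` is
multiplied by all four indicators at `s`, and these sum to one. -/
theorem SquareEnumeration.torusSum_localPairing_dominoInd (E : SquareEnumeration L n)
    (t : Tiling L) {p : ℤ × ℤ → ℤ} (hp : IsPeriodic L p) :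
    ((E.torusSum fun s => localPairing (flow p s) (dominoInd t s) : ℤ) : ZMod 2) =
      (E.torusSum p : ℤ) := by
  have hM := isEdgeFunction_dominoInd t
  have hcast : ∀ f : ℤ × ℤ → ℤ, ((E.torusSum f : ℤ) : ZMod 2) =
      E.torusSum fun s => (f s : ZMod 2) := by
    intro f; simp [torusSum]
  have per : ∀ (a : ℤ × ℤ) (d : Fin 4),
      IsPeriodic L fun s => (p (s + a) : ZMod 2) * (dominoInd t s d : ZMod 2) := by
    intro a d s w hw
    simp only [add_right_comm s w, hp _ w hw, hM.periodic s w hw]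
  have e2 : ∀ s, dominoInd t (s + (1, 0)) 2 = dominoInd t s 0 := fun s => hM.symm s 0
  have e3 : ∀ s, dominoInd t (s + (0, 1)) 3 = dominoInd t s 1 := fun s => hM.symm s 1
  have h1 := E.torusSum_shift_right (per 0 2)
  have h2 := E.torusSum_shift_up (per (1, 0) 3)
  simp only [e2, e3, add_zero, add_assoc, Prod.mk_add_mk, zero_add] at h1 h2
  have two : (2 : ZMod 2) = 0 := rfl
  have h3 := E.torusSum_shift_right (f := fun s => (p s : ZMod 2))
    fun s w hw => by simp only [hp s w hw]
  have hs : ∀ s, (dominoInd t s 0 : ZMod 2) + dominoInd t s 1 + dominoInd t s 2 +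
      dominoInd t s 3 = 1 := by
    intro s
    have := sum_dominoInd t s
    rw [Fin.sum_univ_four] at this
    exact_mod_cast congrArg (Int.cast (R := ZMod 2)) this
  rw [hcast, hcast, ← h3]
  have h4 : ∀ s, ((localPairing (flow p s) (dominoInd t s) : ℤ) : ZMod 2) =
      (p (s + (1, 1)) : ZMod 2) * dominoInd t s 1 + (p s : ZMod 2) * dominoInd t s 2 +
      ((p (s + (1, 0)) : ZMod 2) * dominoInd t s 1 +
        (p (s + (1, 0)) : ZMod 2) * dominoInd t s 2) := by
    intro s
    simp only [localPairing, orderedProduct, flow, sideDiff, Matrix.cons_val]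
    push_cast
    rw [colour_cast]
    linear_combination (-(p (s + (1, 0)) : ZMod 2) * dominoInd t s 1 -
      (p (s + (1, 0)) : ZMod 2) * dominoInd t s 2) * two
  simp only [h4, E.torusSum_add]
  rw [← h1, h2, ← E.torusSum_add, ← E.torusSum_add, ← E.torusSum_add]
  congr 1; ext s
  linear_combination (p (s + (1, 0)) : ZMod 2) * hs s

/-! ### The Kasteleyn condition at a vertex -/

theorem inversionForm_single (a b : Fin n × Fin 4 → ℕ) (β : Fin 4 → Fin n) (σ : Fin 4 → ℤ) :
    inversionForm a b (fun e => if e.1 = β e.2 then σ e.2 else 0) =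
      ∑ d, ∑ c, if a (β d, d) < a (β c, c) ∧ b (β c, c) < b (β d, d) then σ d * σ c else 0 := by
  unfold inversionForm
  rw [Fintype.sum_prod_type_right]
  refine Finset.sum_congr rfl fun d _ => ?_
  rw [Finset.sum_eq_single (β d) (fun i _ hi => by simp [hi]) (by simp),
    Fintype.sum_prod_type_right]
  refine Finset.sum_congr rfl fun c _ => ?_
  rw [Finset.sum_eq_single (β c) (fun i _ hi => by simp [hi]) (by simp)]
  simp

theorem lexCode_lt_iff (i j : Fin n) (c d : Fin 4) :
    lexCode (i, c) < lexCode (j, d) ↔ i < j ∨ i = j ∧ c < d := by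
  have := c.2; have := d.2
  simp only [lexCode, Fin.lt_def, Fin.ext_iff]
  omega

/-- The parity of the number of inversions among the four edges around a vertex, where the
edge in direction `d` joins the `β d`-th black square and the `γ d`-th white square. -/
theorem sum_plaquette_inversions (β γ : Fin 4 → Fin n) (σ : Fin 4 → ℤ)
    (h : (β 0 = β 1 ∧ β 2 = β 3 ∧ γ 0 = γ 3 ∧ γ 1 = γ 2 ∧ σ = ![1, -1, 1, -1]) ∨
      (β 0 = β 3 ∧ β 1 = β 2 ∧ γ 0 = γ 1 ∧ γ 2 = γ 3 ∧ σ = ![-1, 1, -1, 1])) :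
    Even (∑ d, ∑ c, if lexCode (β d, d) < lexCode (β c, c) ∧
      lexCode (γ c, c + 2) < lexCode (γ d, d + 2) then σ d * σ c else 0) := by
  -- The equality case is needed on small tori, where the two black or the two white squares around
  -- a vertex may coincide.
  have tri : ∀ x y : Fin n, (x < y ∧ ¬ y < x ∧ x ≠ y ∧ y ≠ x) ∨ x = y ∨
      (y < x ∧ ¬ x < y ∧ x ≠ y ∧ y ≠ x) := by
    intro x y; omega
  simp only [lexCode_lt_iff]
  rcases h with ⟨h, h', g, g', rfl⟩ | ⟨h, h', g, g', rfl⟩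
  all_goals
    simp only [Fin.sum_univ_four, Matrix.cons_val, h, h', g, g']
    generalize β 3 = b
    generalize γ 3 = w
  · generalize β 1 = b'
    generalize γ 2 = w'
    rcases tri b b' with hb | rfl | hb <;> rcases tri w w' with hw | rfl | hw <;>
      simp [*]
  · generalize β 2 = b'
    generalize γ 1 = w'
    rcases tri b b' with hb | rfl | hb <;> rcases tri w w' with hw | rfl | hw <;>
      simp [*]

/-- The inversions are even in number and the two values `-1` contribute two triangular numbers
equal to `1`. Exactly one of the four edges leaves its black square to the east, so the linear
Kasteleyn term is `±1` and decides the parity. -/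
theorem SquareEnumeration.signExponent_plaquette (E : SquareEnumeration L n)
    {F : ℤ × ℤ → Fin 4 → ℤ} {β : Fin 4 → Fin n} {σ : Fin 4 → ℤ}
    (hF : ∀ i d, F (E.black i) d = if i = β d then σ d else 0)
    (h : (β 0 = β 1 ∧ β 2 = β 3 ∧ E.stepPerm 0 (β 0) = E.stepPerm 3 (β 3) ∧
        E.stepPerm 1 (β 1) = E.stepPerm 2 (β 2) ∧ σ = ![1, -1, 1, -1]) ∨
      (β 0 = β 3 ∧ β 1 = β 2 ∧ E.stepPerm 0 (β 0) = E.stepPerm 1 (β 1) ∧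
        E.stepPerm 2 (β 2) = E.stepPerm 3 (β 3) ∧ σ = ![-1, 1, -1, 1])) :
    Odd (E.signExponent F) := by
  have h1 : (fun e : Fin n × Fin 4 => F (E.black e.1) e.2) =
      fun e => if e.1 = β e.2 then σ e.2 else 0 := by
    ext e; rw [hF]
  have h2 : ∑ i, ∑ d, triangle (F (E.black i) d) = ∑ d, triangle (σ d) := by
    rw [Finset.sum_comm]
    refine Finset.sum_congr rfl fun d _ => ?_
    rw [Finset.sum_eq_single (β d) (fun i _ hi => by rw [hF, if_neg hi]; rfl) (by simp), hF,
      if_pos rfl]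
  have h3 : ∑ i, F (E.black i) 0 = σ 0 := by
    simp [hF]
  have hodd : Odd (∑ d, triangle (σ d) + σ 0) := by
    rcases h with ⟨-, -, -, -, rfl⟩ | ⟨-, -, -, -, rfl⟩ <;> decide
  unfold signExponent
  rw [h1, h2, h3, inversionForm_single, add_assoc]
  exact (sum_plaquette_inversions β (fun d => E.stepPerm d (β d)) σ h).add_odd hodd

open Classical in
/-- The indicator function of the vertices that are equivalent to `v` modulo `L`. -/
noncomputable def vertexInd (L : AddSubgroup (ℤ × ℤ)) (v u : ℤ × ℤ) : ℤ := if u - v ∈ L then 1 else 0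

theorem vertexInd_eq_ite {v u : ℤ × ℤ} {P : Prop} [Decidable P] (h : u - v ∈ L ↔ P) :
    vertexInd L v u = if P then 1 else 0 := by
  unfold vertexInd
  split_ifs <;> tauto

theorem vertexInd_eq_zero {v u : ℤ × ℤ} (h : u - v ∉ L) : vertexInd L v u = 0 := if_neg h

theorem vertexInd_comm (u v : ℤ × ℤ) : vertexInd L u v = vertexInd L v u := by
  have : v - u ∈ L ↔ u - v ∈ L := by rw [← L.neg_mem_iff, neg_sub]
  unfold vertexInd
  split_ifs <;> tauto

theorem isPeriodic_vertexInd (v : ℤ × ℤ) : IsPeriodic L (vertexInd L v) := by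
  intro s w hw
  have : s + w - v ∈ L ↔ s - v ∈ L := by
    rw [add_sub_right_comm]
    exact L.add_mem_cancel_right hw
  unfold vertexInd
  split_ifs <;> tauto

theorem SquareEnumeration.black_sub_mem_iff (E : SquareEnumeration L n) {p : ℤ × ℤ} {j : Fin n}
    (hp : p - E.black j ∈ L) (i : Fin n) : E.black i - p ∈ L ↔ i = j := by
  constructor
  · intro h
    apply E.black_index_unique
    have := L.add_mem h hp
    simpa using this
  · rintro rfl
    have := L.neg_mem hp
    simpa using this

theorem SquareEnumeration.stepPerm_eq (E : SquareEnumeration L n) {p p' : ℤ × ℤ} {j j' : Fin n}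
    (hp : p - E.black j ∈ L) (hp' : p' - E.black j' ∈ L) {d d' : Fin 4}
    (h : p + dir d = p' + dir d') : E.stepPerm d j = E.stepPerm d' j' := by
  refine E.white_index_unique (s := p + dir d) ?_ ?_
  · have := L.add_mem hp (E.stepPerm_spec d j)
    convert this using 1
    abel
  · have := L.add_mem hp' (E.stepPerm_spec d' j')
    rw [h]
    convert this using 1
    abel

theorem isBlack_congr (hL : IsValidLattice L) {s p : ℤ × ℤ} (h : s - p ∈ L) :
    IsBlack s ↔ IsBlack p := by
  rw [← isBlack_add (s := p) (hL.even h), add_sub_cancel]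

theorem SquareEnumeration.signExponent_flow_vertexInd (hL : IsValidLattice L)
    (E : SquareEnumeration L n) (v : ℤ × ℤ) : Odd (E.signExponent (flow (vertexInd L v))) := by
  have hb := E.isBlack_black
  by_cases hv : IsBlack v
  -- If the square with lower left corner `v` is black, the black squares around `v` are the
  -- north-east and south-west ones; otherwise they are the north-west and south-east ones.
  · obtain ⟨b₁, h₁, -⟩ := E.existsUnique_black v hv
    obtain ⟨b₂, h₂, -⟩ := E.existsUnique_black (v - (1, 1)) (by
      unfold IsBlack at *; simp only [Prod.fst_sub, Prod.snd_sub, Int.even_iff] at *; omega)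
    have z10 : ∀ i, vertexInd L v (E.black i + (1, 0)) = 0 := fun i => vertexInd_eq_zero fun h =>
      (isBlack_add_dir _ 0).1 ((isBlack_congr hL h).2 hv) (hb i)
    have z01 : ∀ i, vertexInd L v (E.black i + (0, 1)) = 0 := fun i => vertexInd_eq_zero fun h =>
      (isBlack_add_dir _ 1).1 ((isBlack_congr hL h).2 hv) (hb i)
    have z11 : ∀ i, vertexInd L v (E.black i + (1, 1)) = if i = b₂ then 1 else 0 := fun i =>
      vertexInd_eq_ite (by rw [← E.black_sub_mem_iff h₂, sub_sub_eq_add_sub])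
    have z00 : ∀ i, vertexInd L v (E.black i) = if i = b₁ then 1 else 0 := fun i =>
      vertexInd_eq_ite (E.black_sub_mem_iff h₁ i)
    refine E.signExponent_plaquette (β := ![b₂, b₂, b₁, b₁]) (σ := ![1, -1, 1, -1]) ?_
      (Or.inl ⟨rfl, rfl, E.stepPerm_eq h₂ h₁ ?_, E.stepPerm_eq h₂ h₁ ?_, rfl⟩)
    · intro i d
      rw [flow, colour_of_isBlack (hb i)]
      fin_cases d <;>
        simp [sideDiff, z00, z10, z01, z11, apply_ite Neg.neg] <;> rfl
    · ext <;> simp [dir]; ring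
    · ext <;> simp [dir]; ring
  · obtain ⟨b₁, h₁, -⟩ := E.existsUnique_black (v - (1, 0)) (by
      unfold IsBlack at *; simp only [Prod.fst_sub, Prod.snd_sub, Int.even_iff] at *; omega)
    obtain ⟨b₂, h₂, -⟩ := E.existsUnique_black (v - (0, 1)) (by
      unfold IsBlack at *; simp only [Prod.fst_sub, Prod.snd_sub, Int.even_iff] at *; omega)
    have z00 : ∀ i, vertexInd L v (E.black i) = 0 := fun i => vertexInd_eq_zero fun h =>
      hv ((isBlack_congr hL h).1 (hb i))
    have z11 : ∀ i, vertexInd L v (E.black i + (1, 1)) = 0 := fun i => vertexInd_eq_zero fun h => by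
      refine hv ((isBlack_congr hL h).1 ?_)
      rw [isBlack_add (by decide)]
      exact hb i
    have z10 : ∀ i, vertexInd L v (E.black i + (1, 0)) = if i = b₁ then 1 else 0 := fun i =>
      vertexInd_eq_ite (by rw [← E.black_sub_mem_iff h₁, sub_sub_eq_add_sub])
    have z01 : ∀ i, vertexInd L v (E.black i + (0, 1)) = if i = b₂ then 1 else 0 := fun i =>
      vertexInd_eq_ite (by rw [← E.black_sub_mem_iff h₂, sub_sub_eq_add_sub])
    refine E.signExponent_plaquette (β := ![b₁, b₂, b₂, b₁]) (σ := ![-1, 1, -1, 1]) ?_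
      (Or.inr ⟨rfl, rfl, E.stepPerm_eq h₁ h₂ ?_, E.stepPerm_eq h₂ h₁ ?_, rfl⟩)
    · intro i d
      rw [flow, colour_of_isBlack (hb i)]
      fin_cases d <;>
        simp [sideDiff, z00, z10, z01, z11, apply_ite Neg.neg] <;> rfl
    · ext <;> simp [dir]
    · ext <;> simp [dir] <;> ring

theorem SquareEnumeration.torusSum_vertexInd (hL : IsValidLattice L)
    (E : SquareEnumeration L n) (v : ℤ × ℤ) : E.torusSum (vertexInd L v) = 1 := by
  unfold torusSum
  simp only [vertexInd_comm v]
  by_cases hv : IsBlack v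
  · obtain ⟨i, hi, hu⟩ := E.existsUnique_black v hv
    rw [Finset.sum_eq_single i (fun j _ hj => vertexInd_eq_zero fun h => hj (hu j h)) (by simp), vertexInd, if_pos hi,
      Finset.sum_eq_zero fun j _ => vertexInd_eq_zero fun h =>
        E.not_isBlack_white j ((isBlack_congr hL h).1 hv)]
    rfl
  · obtain ⟨i, hi, hu⟩ := E.existsUnique_white v hv
    rw [add_comm, Finset.sum_eq_single i (fun j _ hj => vertexInd_eq_zero fun h => hj (hu j h)) (by simp),
      vertexInd, if_pos hi, Finset.sum_eq_zero fun j _ => vertexInd_eq_zero fun h =>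
        hv ((isBlack_congr hL h).2 (E.isBlack_black j))]
    rfl

theorem SquareEnumeration.eq_sum_vertexInd (hL : IsValidLattice L) (E : SquareEnumeration L n)
    {p : ℤ × ℤ → ℤ} (hp : IsPeriodic L p) :
    p = ∑ i, p (E.black i) • vertexInd L (E.black i) +
      ∑ j, p (E.white j) • vertexInd L (E.white j) := by
  have h : ∀ u, p u = E.torusSum (fun v => p v * vertexInd L u v) := by
    intro u
    rw [← mul_one (p u), ← E.torusSum_vertexInd hL u]
    simp only [torusSum, mul_add, Finset.mul_sum]
    congr 1 <;>
    · refine Finset.sum_congr rfl fun i _ => ?_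
      simp only [vertexInd]
      split_ifs with h
      · rw [hp.eq_of_sub_mem h]
      · simp
  ext u
  conv_lhs => rw [h u]
  simp [torusSum, vertexInd_comm u]

/-! ### Dependence of the sign change on periods only -/

/-- The change, modulo two, of the sign exponent of the tiling `t` when `4 k` is added to its
height function. -/
noncomputable def SquareEnumeration.signChange (E : SquareEnumeration L n) (t : Tiling L)
    (k : ℤ × ℤ → ℤ) : ZMod 2 :=
  (E.signExponent (flow k) + E.torusSum fun s => localPairing (flow k s) (dominoInd t s) : ℤ)

theorem SquareEnumeration.signExponent_add_flow (hL : IsValidLattice L)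
    (E : SquareEnumeration L n) (t : Tiling L) {k : ℤ × ℤ → ℤ} (hk : IsQuasiperiodic L k) :
    (E.signExponent (dominoInd t + flow k) : ZMod 2) =
      E.signExponent (dominoInd t) + E.signChange t k := by
  rw [E.signExponent_add (isEdgeFunction_dominoInd t) (isEdgeFunction_flow hL hk) (sum_flow k),
    signChange]
  push_cast
  ring

theorem SquareEnumeration.signChange_add (hL : IsValidLattice L)
    (E : SquareEnumeration L n) (t : Tiling L) {k k' : ℤ × ℤ → ℤ} (hk : IsQuasiperiodic L k)
    (hk' : IsQuasiperiodic L k') :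
    E.signChange t (k + k') = E.signChange t k + E.signChange t k' + (E.cupProduct k' k : ℤ) := by
  have h : (E.torusSum fun s => localPairing (flow (k + k') s) (dominoInd t s)) =
      (E.torusSum fun s => localPairing (flow k s) (dominoInd t s)) +
      E.torusSum fun s => localPairing (flow k' s) (dominoInd t s) := by
    rw [← E.torusSum_add]
    congr 1; ext s
    simp only [flow_add, localPairing, orderedProduct, Pi.add_apply]
    ring
  have h' := E.signExponent_add (isEdgeFunction_flow hL hk) (isEdgeFunction_flow hL hk')
    (sum_flow k')
  simp only [localPairing_flow] at h'
  simp only [signChange, h]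
  rw [flow_add]
  push_cast
  rw [h', cupProduct]
  ring

/-- The odd exponent of the flow cancels against the pairing with the tiling, which is the torus sum
`1`. -/
theorem SquareEnumeration.signChange_vertexInd (hL : IsValidLattice L)
    (E : SquareEnumeration L n) (t : Tiling L) (v : ℤ × ℤ) :
    E.signChange t (vertexInd L v) = 0 := by
  rw [signChange, Int.cast_add, E.torusSum_localPairing_dominoInd t (isPeriodic_vertexInd v),
    E.torusSum_vertexInd hL, (ZMod.intCast_eq_one_iff_odd).2 (E.signExponent_flow_vertexInd hL v)]
  rfl

/-- The periodic functions that do not change the sign exponent form a subgroup. -/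
noncomputable def SquareEnumeration.neutralSubgroup (hL : IsValidLattice L)
    (E : SquareEnumeration L n) (t : Tiling L) : AddSubgroup (ℤ × ℤ → ℤ) where
  carrier := {p | IsPeriodic L p ∧ E.signChange t p = 0}
  zero_mem' := by
    have h0 : IsPeriodic L (0 : ℤ × ℤ → ℤ) := fun _ _ _ => rfl
    have := E.signChange_add hL t h0.isQuasiperiodic h0.isQuasiperiodic
    rw [E.cupProduct_periodic_left h0.isQuasiperiodic h0] at this
    refine ⟨h0, ?_⟩
    simpa using this
  add_mem' := by
    rintro p p' ⟨hp, h⟩ ⟨hp', h'⟩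
    refine ⟨fun s w hw => by simp only [Pi.add_apply, hp s w hw, hp' s w hw], ?_⟩
    rw [E.signChange_add hL t hp.isQuasiperiodic hp'.isQuasiperiodic, h, h',
      E.cupProduct_periodic_left hp.isQuasiperiodic hp']
    simp
  neg_mem' := by
    rintro p ⟨hp, h⟩
    have hp' : IsPeriodic L (-p) := fun s w hw => by simp only [Pi.neg_apply, hp s w hw]
    have h0 : IsPeriodic L (0 : ℤ × ℤ → ℤ) := fun _ _ _ => rfl
    have h1 := E.signChange_add hL t h0.isQuasiperiodic h0.isQuasiperiodic
    have h2 := E.signChange_add hL t hp.isQuasiperiodic hp'.isQuasiperiodic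
    rw [E.cupProduct_periodic_left h0.isQuasiperiodic h0] at h1
    rw [E.cupProduct_periodic_left hp.isQuasiperiodic hp', h, add_neg_cancel] at h2
    refine ⟨hp', ?_⟩
    simp only [add_zero, Int.cast_zero, zero_add, left_eq_add] at h1 h2
    rw [← h2, h1]

/-- Cup products of periodic functions vanish, so `signChange` is additive on them, and vertex
indicators generate them. -/
theorem SquareEnumeration.signChange_periodic (hL : IsValidLattice L) (E : SquareEnumeration L n)
    (t : Tiling L) {p : ℤ × ℤ → ℤ} (hp : IsPeriodic L p) : E.signChange t p = 0 := by
  suffices p ∈ E.neutralSubgroup hL t from this.2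
  have hv : ∀ v, vertexInd L v ∈ E.neutralSubgroup hL t := fun v =>
    ⟨isPeriodic_vertexInd v, E.signChange_vertexInd hL t v⟩
  rw [E.eq_sum_vertexInd hL hp]
  exact add_mem (sum_mem fun i _ => zsmul_mem (hv _) _) (sum_mem fun j _ => zsmul_mem (hv _) _)

theorem SquareEnumeration.signChange_eq_of_hasPeriods (hL : IsValidLattice L)
    (E : SquareEnumeration L n) (t : Tiling L) {k k' : ℤ × ℤ → ℤ} {φ : ℝ × ℝ}
    (hk : HasPeriods L k φ) (hk' : HasPeriods L k' φ) : E.signChange t k = E.signChange t k' := by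
  have hp : IsPeriodic L (k - k') := by
    intro s w hw
    have h := hk w hw s
    rw [← hk' w hw s] at h
    have := Int.cast_injective h
    simp only [Pi.sub_apply]
    linarith
  have h := E.signChange_add hL t hk'.isQuasiperiodic hp.isQuasiperiodic
  rw [E.cupProduct_periodic_left hk'.isQuasiperiodic hp, E.signChange_periodic hL t hp,
    add_sub_cancel] at h
  simpa using h

/-! ### The sign of a tiling -/

theorem negOnePow_sum {ι : Type*} (s : Finset ι) (f : ι → ℤ) :
    (∑ i ∈ s, f i).negOnePow = ∏ i ∈ s, (f i).negOnePow := by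
  classical
  induction s using Finset.induction_on with
  | empty => rfl
  | insert a s ha ih => rw [Finset.sum_insert ha, Finset.prod_insert ha, Int.negOnePow_add, ih]

theorem sign_eq_negOnePow (σ : Equiv.Perm (Fin n)) :
    Equiv.Perm.sign σ = (∑ i, ∑ k, if i < k ∧ σ k < σ i then (1 : ℤ) else 0).negOnePow := by
  rw [Equiv.Perm.sign_eq_prod_prod_Ioi, negOnePow_sum]
  refine Finset.prod_congr rfl fun i _ => ?_
  rw [negOnePow_sum]
  refine Finset.prod_subset_one_on_sdiff (Finset.subset_univ _) ?_ ?_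
  · intro k hk
    simp only [Finset.mem_sdiff, Finset.mem_univ, Finset.mem_Ioi, true_and] at hk
    simp [hk]
  · intro k hk
    rw [Finset.mem_Ioi] at hk
    rcases lt_or_gt_of_ne (σ.injective.ne hk.ne) with h | h <;>
      simp [hk, h, h.not_gt]

/-- On a 0/1 matching the triangular numbers vanish. Distinct dominoes use distinct squares, so ties
broken by direction never matter and the inversion form counts the inversions of the permutation. -/
theorem SquareEnumeration.tilingSign_eq (E : SquareEnumeration L n) (t : Tiling L) :
    E.tilingSign t = (E.signExponent (dominoInd t)).negOnePow := by
  choose D hD using fun i => exists_partner_eq t (E.black i)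
  have hind : ∀ i d, dominoInd t (E.black i) d = if d = D i then 1 else 0 := by
    intro i d
    simp only [dominoInd, hD, add_right_inj, dir_injective.eq_iff, eq_comm]
  have hstep : ∀ i, E.stepPerm (D i) i = E.matchPerm t i := by
    intro i
    refine E.white_index_unique (E.stepPerm_spec _ i) ?_
    rw [← hD]
    exact E.matchIndex_spec t i
  have htri : ∑ i, ∑ d, triangle (dominoInd t (E.black i) d) = 0 := by
    refine Finset.sum_eq_zero fun i _ => Finset.sum_eq_zero fun d _ => ?_
    rw [hind]
    split_ifs <;> rfl
  have hinv : inversionForm lexCode (lexCode ∘ E.edgeEquiv)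
      (fun e => dominoInd t (E.black e.1) e.2) =
      ∑ i, ∑ k, if i < k ∧ E.matchPerm t k < E.matchPerm t i then (1 : ℤ) else 0 := by
    unfold inversionForm
    simp only [Fintype.sum_prod_type]
    refine Finset.sum_congr rfl fun i _ => ?_
    rw [Finset.sum_eq_single (D i) (fun d _ hd => by simp [hind, hd]) (by simp)]
    refine Finset.sum_congr rfl fun k _ => ?_
    rw [Finset.sum_eq_single (D k) (fun d _ hd => by simp [hind, hd]) (by simp)]
    simp only [hind, Function.comp, edgeEquiv, Equiv.coe_fn_mk, lexCode_lt_iff, hstep, if_true,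
      mul_one, (E.matchPerm t).injective.eq_iff]
    refine if_congr ?_ rfl rfl
    constructor
    · rintro ⟨h | ⟨rfl, h⟩, h' | ⟨h', h''⟩⟩
      · exact ⟨h, h'⟩
      · exact absurd h (by simp [h'])
      · exact absurd h' (lt_irrefl _)
      · exact absurd h (lt_irrefl _)
    · rintro ⟨h, h'⟩
      exact ⟨Or.inl h, Or.inl h'⟩
  unfold tilingSign signExponent
  rw [hinv, htri, add_zero, Int.negOnePow_add, ← sign_eq_negOnePow, negOnePow_sum]
  congr 1
  refine Finset.prod_congr rfl fun i _ => ?_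
  have h0 : E.black i + (1, 0) = E.black i + dir 0 := rfl
  rw [hind]
  simp only [edgeSign, hD, h0, add_right_inj, dir_injective.eq_iff]
  by_cases h : D i = 0
  · simp [h]
  · simp [h, Ne.symm h]

/-! ### Height differences and fluxes -/

theorem int_prod_induction {P : ℤ × ℤ → Prop} (h0 : P 0) (h1 : ∀ s, P s ↔ P (s + (1, 0)))
    (h2 : ∀ s, P s ↔ P (s + (0, 1))) (s : ℤ × ℤ) : P s := by
  obtain ⟨x, y⟩ := s
  have hx : ∀ x : ℤ, P (x, 0) := by
    intro x
    induction x using Int.induction_on with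
    | zero => exact h0
    | succ i ih => simpa using (h1 _).1 ih
    | pred i ih => exact (h1 _).2 (by simpa using ih)
  induction y using Int.induction_on with
  | zero => exact hx x
  | succ i ih => simpa using (h2 _).1 ih
  | pred i ih => exact (h2 _).2 (by simpa using ih)

theorem exists_height_difference {t t' : Tiling L} {h h' : ℤ × ℤ → ℤ}
    (ht : IsHeightFunction t h) (ht' : IsHeightFunction t' h') :
    ∃ k : ℤ × ℤ → ℤ, ∀ u, h' u = h u + 4 * k u := by
  rw [isHeightFunction_iff] at ht ht'
  have hd : ∀ s d, (4 : ℤ) ∣ sideDiff h' s d - sideDiff h s d := by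
    intro s d
    refine ⟨colour s * (dominoInd t' s d - dominoInd t s d), ?_⟩
    have h1 := ht.2 s d
    have h2 := ht'.2 s d
    have h3 := colour_mul_self s
    linear_combination colour s * h2 - colour s * h1 -
      (sideDiff h' s d - sideDiff h s d) * h3
  have key : ∀ u, (4 : ℤ) ∣ h' u - h u := by
    intro u
    refine int_prod_induction (P := fun u => (4 : ℤ) ∣ h' u - h u) ?_ ?_ ?_ u
    · simp [ht.1, ht'.1]
    · intro s
      have := hd s 3
      simp only [sideDiff, Matrix.cons_val] at this
      omega
    · intro s
      have := hd s 2
      simp only [sideDiff, Matrix.cons_val] at this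
      omega
  choose k hk using key
  exact ⟨k, fun u => by rw [← hk]; ring⟩

theorem sub_pairing (φ ψ : ℝ × ℝ) (u : ℤ × ℤ) : pairing (φ - ψ) u = pairing φ u - pairing ψ u := by
  simp only [pairing, Prod.fst_sub, Prod.snd_sub]; ring

theorem hasPeriods_height_difference {h h' k : ℤ × ℤ → ℤ} {φ φ' : ℝ × ℝ}
    (hφ : ∀ v ∈ L, ∀ u, ((h (u + v) - h u : ℤ) : ℝ) = 4 * pairing φ v)
    (hφ' : ∀ v ∈ L, ∀ u, ((h' (u + v) - h' u : ℤ) : ℝ) = 4 * pairing φ' v)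
    (hk : ∀ u, h' u = h u + 4 * k u) : HasPeriods L k (φ' - φ) := by
  intro w hw u
  have h1 := hφ w hw u
  have h2 := hφ' w hw u
  rw [sub_pairing]
  simp only [hk] at h2
  push_cast at h1 h2 ⊢
  linarith

theorem dominoInd_eq_add_flow {t t' : Tiling L} {h h' k : ℤ × ℤ → ℤ}
    (ht : IsHeightFunction t h) (ht' : IsHeightFunction t' h')
    (hk : ∀ u, h' u = h u + 4 * k u) : dominoInd t' = dominoInd t + flow k := by
  rw [isHeightFunction_iff] at ht ht'
  ext s d
  have h1 := ht.2 s d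
  have h2 := ht'.2 s d
  have h3 : sideDiff h' s d = sideDiff h s d + 4 * sideDiff k s d := by
    fin_cases d <;> simp [sideDiff, hk] <;> ring
  simp only [Pi.add_apply, flow]
  rw [h3] at h2
  linarith

theorem sub_mem_dualLattice {t t' : Tiling L} {φ φ' : ℝ × ℝ} (h : HasFlux t φ)
    (h' : HasFlux t' φ') : φ' - φ ∈ dualLattice L := by
  obtain ⟨g, hg, hφ⟩ := h
  obtain ⟨g', hg', hφ'⟩ := h'
  obtain ⟨k, hk⟩ := exists_height_difference hg hg'
  intro w hw
  exact ⟨_, (hasPeriods_height_difference hφ hφ' hk w hw 0).symm⟩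

theorem SquareEnumeration.signExponent_eq_add_signChange (hL : IsValidLattice L)
    (E : SquareEnumeration L n) {t t' : Tiling L} {φ φ' : ℝ × ℝ} (h : HasFlux t φ)
    (h' : HasFlux t' φ') {k : ℤ × ℤ → ℤ} (hk : HasPeriods L k (φ' - φ)) :
    (E.signExponent (dominoInd t') : ZMod 2) =
      E.signExponent (dominoInd t) + E.signChange t k := by
  obtain ⟨g, hg, hφ⟩ := h
  obtain ⟨g', hg', hφ'⟩ := h'
  obtain ⟨l, hl⟩ := exists_height_difference hg hg'
  have hp := hasPeriods_height_difference hφ hφ' hl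
  rw [dominoInd_eq_add_flow hg hg' hl, E.signExponent_add_flow hL t hp.isQuasiperiodic,
    E.signChange_eq_of_hasPeriods hL t hp hk]

/-- This supplies an integer height change with prescribed periods: translation by `w` in `L` adds
an integer, which passes through the floor. -/
theorem hasPeriods_floor_pairing {ψ : ℝ × ℝ} (hψ : ψ ∈ dualLattice L) :
    HasPeriods L (fun u => ⌊pairing ψ u⌋) ψ := by
  intro w hw u
  obtain ⟨k, hk⟩ := hψ w hw
  simp only
  rw [pairing_add, hk, Int.floor_add_intCast]
  push_cast; ring

/-! ### Index of the lattice and determinant of the dual lattice -/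

theorem mem_dualLattice_of_generators {w₀ w₁ : ℤ × ℤ} (hL : L = AddSubgroup.closure {w₀, w₁})
    {φ : ℝ × ℝ} {a b : ℤ} (h₀ : pairing φ w₀ = a) (h₁ : pairing φ w₁ = b) :
    φ ∈ dualLattice L := by
  intro w hw
  rw [hL, AddSubgroup.mem_closure_pair] at hw
  obtain ⟨x, y, rfl⟩ := hw
  refine ⟨x * a + y * b, ?_⟩
  push_cast
  rw [← h₀, ← h₁, pairing_add]
  simp only [pairing, Prod.smul_fst, Prod.smul_snd, smul_eq_mul]
  push_cast; ring

theorem index_eq_natAbs_det_generators {w₀ w₁ : ℤ × ℤ} (hL : L = AddSubgroup.closure {w₀, w₁})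
    (hdet : w₀.1 * w₁.2 - w₀.2 * w₁.1 ≠ 0) :
    L.index = (w₀.1 * w₁.2 - w₀.2 * w₁.1).natAbs := by
  have h₀ : w₀ ∈ L := by rw [hL]; exact AddSubgroup.subset_closure (by simp)
  have h₁ : w₁ ∈ L := by rw [hL]; exact AddSubgroup.subset_closure (by simp)
  have hli : LinearIndependent ℤ ![(⟨w₀, h₀⟩ : L), ⟨w₁, h₁⟩] := by
    rw [LinearIndependent.pair_iff]
    intro x y hxy
    have h := congrArg Subtype.val hxy
    have e1 := congrArg Prod.fst h
    have e2 := congrArg Prod.snd h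
    simp at e1 e2
    constructor
    · refine (mul_eq_zero.1 (?_ : x * (w₀.1 * w₁.2 - w₀.2 * w₁.1) = 0)).resolve_right hdet
      linear_combination w₁.2 * e1 - w₁.1 * e2
    · refine (mul_eq_zero.1 (?_ : y * (w₀.1 * w₁.2 - w₀.2 * w₁.1) = 0)).resolve_right hdet
      linear_combination w₀.1 * e2 - w₀.2 * e1
  have hsp : ⊤ ≤ Submodule.span ℤ (Set.range ![(⟨w₀, h₀⟩ : L), ⟨w₁, h₁⟩]) := by
    rintro ⟨w, hw⟩ -
    have hw' := hw
    rw [hL, AddSubgroup.mem_closure_pair] at hw'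
    obtain ⟨x, y, h⟩ := hw'
    simp only [Matrix.range_cons, Matrix.range_empty, Set.union_empty, Set.singleton_union]
    rw [Submodule.mem_span_pair]
    exact ⟨x, y, Subtype.ext h⟩
  rw [AddSubgroup.index_eq_natAbs_det (Module.Basis.finTwoProd ℤ) L (Module.Basis.mk hli hsp)]
  congr 1
  rw [Module.Basis.det_apply, Matrix.det_fin_two]
  simp [Module.Basis.toMatrix_apply, mul_comm]

theorem SquareEnumeration.index_eq (hL : IsValidLattice L) (E : SquareEnumeration L n) :
    L.index = 2 * n := by
  have key : ∀ s p : ℤ × ℤ, (s : (ℤ × ℤ) ⧸ L) = p ↔ p - s ∈ L := by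
    intro s p
    rw [QuotientAddGroup.eq, neg_add_eq_sub]
  let f : Fin n ⊕ Fin n → (ℤ × ℤ) ⧸ L :=
    Sum.elim (fun i => (E.black i : (ℤ × ℤ) ⧸ L)) fun j => (E.white j : (ℤ × ℤ) ⧸ L)
  have hf : Function.Bijective f := by
    constructor
    · rintro (i | i) (j | j) h
      · rw [E.black_index_unique ((key _ _).1 h)]
      · exact absurd ((isBlack_congr hL ((key _ _).1 h)).2 (E.isBlack_black i))
          (E.not_isBlack_white j)
      · exact absurd ((isBlack_congr hL ((key _ _).1 h)).1 (E.isBlack_black j))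
          (E.not_isBlack_white i)
      · rw [E.white_index_unique (s := E.white j) (i := i) (j := j) ((key _ _).1 h)
          (by rw [sub_self]; exact L.zero_mem)]
    · intro q
      obtain ⟨s, rfl⟩ := QuotientAddGroup.mk_surjective q
      by_cases hs : IsBlack s
      · obtain ⟨i, hi, -⟩ := E.existsUnique_black s hs
        exact ⟨Sum.inl i, (key _ _).2 hi⟩
      · obtain ⟨i, hi, -⟩ := E.existsUnique_white s hs
        exact ⟨Sum.inr i, (key _ _).2 hi⟩
  rw [AddSubgroup.index, ← Nat.card_congr (Equiv.ofBijective f hf)]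
  simp [two_mul]

/-- The determinant of two vectors of the plane. -/
def planeDet (φ ψ : ℝ × ℝ) : ℝ := φ.1 * ψ.2 - φ.2 * ψ.1

theorem eq_repr_dualLattice (v : Module.Basis (Fin 2) ℤ (dualLattice L)) {φ : ℝ × ℝ}
    (hφ : φ ∈ dualLattice L) :
    ∃ x y : ℤ, φ = (x : ℝ) • (v 0 : ℝ × ℝ) + (y : ℝ) • (v 1 : ℝ × ℝ) := by
  have h := v.sum_repr ⟨φ, hφ⟩
  rw [Fin.sum_univ_two] at h
  refine ⟨v.repr ⟨φ, hφ⟩ 0, v.repr ⟨φ, hφ⟩ 1, (congrArg Subtype.val h).symm.trans ?_⟩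
  simp only [AddSubgroup.coe_add, AddSubgroup.coe_zsmul, Int.cast_smul_eq_zsmul]

theorem SquareEnumeration.planeDet_basis (hL : IsValidLattice L) (E : SquareEnumeration L n)
    (v : Module.Basis (Fin 2) ℤ (dualLattice L)) :
    ∃ e : ℤ, IsUnit e ∧ 2 * n * planeDet (v 0) (v 1) = e := by
  have hi := E.index_eq hL
  obtain ⟨w₀, w₁, hw, hdet, -, -⟩ := hL
  rw [index_eq_natAbs_det_generators hw hdet] at hi
  have h₀ : w₀ ∈ L := by rw [hw]; exact AddSubgroup.subset_closure (by simp)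
  have h₁ : w₁ ∈ L := by rw [hw]; exact AddSubgroup.subset_closure (by simp)
  set D : ℤ := w₀.1 * w₁.2 - w₀.2 * w₁.1 with hD
  have hDr : (D : ℝ) ≠ 0 := by exact_mod_cast hdet
  have hDe : (D : ℝ) = w₀.1 * w₁.2 - w₀.2 * w₁.1 := by rw [hD]; push_cast; ring
  -- The vectors of `d₀` and `d₁` form the basis dual to `w₀, w₁`, of determinant `1 / D`. Expanding
  -- them in `v` shows that the integer matrix of pairings of `v` with `w₀, w₁` has unit
  -- determinant.
  have d₀ : ((w₁.2 / D, -w₁.1 / D) : ℝ × ℝ) ∈ dualLattice L := by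
    refine mem_dualLattice_of_generators hw (a := 1) (b := 0) ?_ ?_ <;>
      simp only [pairing] <;> field_simp <;> push_cast <;> linarith
  have d₁ : ((-w₀.2 / D, w₀.1 / D) : ℝ × ℝ) ∈ dualLattice L := by
    refine mem_dualLattice_of_generators hw (a := 0) (b := 1) ?_ ?_ <;>
      simp only [pairing] <;> field_simp <;> push_cast <;> linarith
  obtain ⟨a, b, hab⟩ := eq_repr_dualLattice v d₀
  obtain ⟨c, d, hcd⟩ := eq_repr_dualLattice v d₁
  obtain ⟨m₀₀, e₀₀⟩ := (v 0).2 w₀ h₀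
  obtain ⟨m₀₁, e₀₁⟩ := (v 0).2 w₁ h₁
  obtain ⟨m₁₀, e₁₀⟩ := (v 1).2 w₀ h₀
  obtain ⟨m₁₁, e₁₁⟩ := (v 1).2 w₁ h₁
  have hm : planeDet (v 0) (v 1) * D = (m₀₀ * m₁₁ - m₀₁ * m₁₀ : ℤ) := by
    push_cast
    rw [← e₀₀, ← e₀₁, ← e₁₀, ← e₁₁, hDe]
    simp only [pairing, planeDet]
    ring
  have hA : (1 : ℝ) = (a * d - b * c : ℤ) * (planeDet (v 0) (v 1) * D) := by
    have h := congrArg (fun p : (ℝ × ℝ) × (ℝ × ℝ) => planeDet p.1 p.2)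
      (Prod.ext hab hcd :
        (((w₁.2 / D, -w₁.1 / D) : ℝ × ℝ), ((-w₀.2 / D, w₀.1 / D) : ℝ × ℝ)) = (_, _))
    simp only [planeDet, Prod.fst_add, Prod.snd_add, Prod.smul_fst, Prod.smul_snd,
      smul_eq_mul] at h
    have h2 : (w₁.2 / D * (w₀.1 / D) - -w₁.1 / D * (-w₀.2 / D) : ℝ) * D = 1 := by
      field_simp
      linarith
    rw [← h2, h]
    simp only [planeDet]
    push_cast
    ring
  rw [hm] at hA
  have hunit : IsUnit (m₀₀ * m₁₁ - m₀₁ * m₁₀) :=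
    IsUnit.of_mul_eq_one (a * d - b * c) (by rw [mul_comm]; exact_mod_cast hA.symm)
  rcases Int.natAbs_eq D with h | h
  · refine ⟨_, hunit, ?_⟩
    rw [← hm, h, hi]
    push_cast; ring
  · refine ⟨_, hunit.neg, ?_⟩
    rw [Int.cast_neg, ← hm, h, hi]
    push_cast; ring

/-! ### The sign in coordinates of the dual lattice -/

theorem negOnePow_congr {a b : ℤ} (h : (a : ZMod 2) = b) : a.negOnePow = b.negOnePow := by
  rw [Int.negOnePow_eq_iff, even_iff_two_dvd]
  rw [eq_comm] at h
  exact (ZMod.intCast_eq_intCast_iff_dvd_sub b a 2).1 h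

theorem planeDet_combination (u w : ℝ × ℝ) (x y x' y' : ℝ) :
    planeDet (x • u + y • w) (x' • u + y' • w) = (x * y' - y * x') * planeDet u w := by
  simp only [planeDet, Prod.fst_add, Prod.snd_add, Prod.smul_fst, Prod.smul_snd, smul_eq_mul]
  ring

theorem eq_of_combination_eq {u w : ℝ × ℝ} (h : planeDet u w ≠ 0) {x y x' y' : ℝ}
    (he : x • u + y • w = x' • u + y' • w) : x = x' ∧ y = y' := by
  have h1 := congrArg (fun p => planeDet p w) he
  have h2 := congrArg (fun p => planeDet u p) he
  simp only [planeDet, Prod.fst_add, Prod.snd_add, Prod.smul_fst, Prod.smul_snd,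
    smul_eq_mul] at h1 h2 h
  constructor
  · apply mul_right_cancel₀ h; linear_combination h1
  · apply mul_right_cancel₀ h; linear_combination h2

theorem combination_mem_dualLattice (v : Module.Basis (Fin 2) ℤ (dualLattice L)) (x y : ℤ) :
    (x : ℝ) • (v 0 : ℝ × ℝ) + (y : ℝ) • (v 1 : ℝ × ℝ) ∈ dualLattice L := by
  have := (x • v 0 + y • v 1).2
  simpa only [AddSubgroup.coe_add, AddSubgroup.coe_zsmul, Int.cast_smul_eq_zsmul] using this

theorem SquareEnumeration.exists_signChange_eq (hL : IsValidLattice L) (E : SquareEnumeration L n)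
    (v : Module.Basis (Fin 2) ℤ (dualLattice L)) (t : Tiling L) :
    ∃ α β : ℤ, ∀ x y : ℤ, E.signChange t
      (fun u => ⌊pairing ((x : ℝ) • (v 0 : ℝ × ℝ) + (y : ℝ) • (v 1 : ℝ × ℝ)) u⌋) =
        (α * x + β * y + x * y : ℤ) := by
  obtain ⟨e, he, hdet⟩ := E.planeDet_basis hL v
  have he2 : (e : ZMod 2) = 1 := by
    rcases Int.isUnit_iff.1 he with rfl | rfl <;> rfl
  set k : ℤ × ℤ → ℤ × ℤ → ℤ := fun p u =>
    ⌊pairing ((p.1 : ℝ) • (v 0 : ℝ × ℝ) + (p.2 : ℝ) • (v 1 : ℝ × ℝ)) u⌋ with hk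
  have hper : ∀ p : ℤ × ℤ, HasPeriods L (k p)
      ((p.1 : ℝ) • (v 0 : ℝ × ℝ) + (p.2 : ℝ) • (v 1 : ℝ × ℝ)) := fun p =>
    hasPeriods_floor_pairing (combination_mem_dualLattice v p.1 p.2)
  have hcup : ∀ p q : ℤ × ℤ, E.cupProduct (k q) (k p) = (q.1 * p.2 - q.2 * p.1) * e := by
    intro p q
    have h := E.cupProduct_eq (hper q) (hper p)
    have h2 := planeDet_combination (v 0 : ℝ × ℝ) (v 1 : ℝ × ℝ) q.1 q.2 p.1 p.2
    rw [planeDet] at h2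
    rw [h2, mul_left_comm, hdet] at h
    exact_mod_cast h
  have hadd : ∀ p q : ℤ × ℤ, E.signChange t (k (p + q)) = E.signChange t (k p) +
      E.signChange t (k q) + (q.1 * p.2 - q.2 * p.1 : ℤ) := by
    intro p q
    have h := (hper p).add (hper q)
    have hs : ((p.1 : ℝ) • (v 0 : ℝ × ℝ) + (p.2 : ℝ) • (v 1 : ℝ × ℝ)) +
        ((q.1 : ℝ) • (v 0 : ℝ × ℝ) + (q.2 : ℝ) • (v 1 : ℝ × ℝ)) =
        (((p + q).1 : ℤ) : ℝ) • (v 0 : ℝ × ℝ) + (((p + q).2 : ℤ) : ℝ) • (v 1 : ℝ × ℝ) := by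
      simp only [Prod.fst_add, Prod.snd_add]; push_cast; module
    rw [hs] at h
    rw [E.signChange_eq_of_hasPeriods hL t (hper (p + q)) h,
      E.signChange_add hL t (hper p).isQuasiperiodic (hper q).isQuasiperiodic, hcup, Int.cast_mul,
      he2, mul_one]
  have two : (2 : ZMod 2) = 0 := rfl
  -- Modulo 2 the determinant in `hadd` is the polarisation of `x * y`, so subtracting this product
  -- leaves a homomorphism, determined by its values on the two unit vectors.
  let H : ℤ × ℤ →+ ZMod 2 := AddMonoidHom.mk'
    (fun p => E.signChange t (k p) - (p.1 * p.2 : ℤ)) (by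
      intro p q
      rw [hadd]
      simp only [Prod.fst_add, Prod.snd_add]
      push_cast
      linear_combination (-(p.1 : ZMod 2) * q.2) * two)
  obtain ⟨α, hα⟩ := ZMod.intCast_surjective (H (1, 0))
  obtain ⟨β, hβ⟩ := ZMod.intCast_surjective (H (0, 1))
  refine ⟨α, β, fun x y => ?_⟩
  have h1 : H (x, y) = x • H (1, 0) + y • H (0, 1) := by
    rw [← map_zsmul, ← map_zsmul, ← map_add]
    simp
  have h2 : H (x, y) = E.signChange t (k (x, y)) - (x * y : ℤ) := rfl
  have h3 : E.signChange t (k (x, y)) = H (x, y) + (x * y : ℤ) := by rw [h2]; ring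
  rw [h1, ← hα, ← hβ] at h3
  refine h3.trans ?_
  push_cast
  simp only [zsmul_eq_mul]
  ring

theorem SquareEnumeration.exists_tilingSign_eq (hL : IsValidLattice L) (E : SquareEnumeration L n)
    (v : Module.Basis (Fin 2) ℤ (dualLattice L)) {t : Tiling L} {φ : ℝ × ℝ} (ht : HasFlux t φ) :
    ∃ α β : ℤ, ∀ (t' : Tiling L) (x y : ℤ),
      HasFlux t' (φ + ((x : ℝ) • (v 0 : ℝ × ℝ) + (y : ℝ) • (v 1 : ℝ × ℝ))) →
        E.tilingSign t' = E.tilingSign t * (α * x + β * y + x * y).negOnePow := by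
  obtain ⟨α, β, h⟩ := E.exists_signChange_eq hL v t
  refine ⟨α, β, fun t' x y ht' => ?_⟩
  have hp := hasPeriods_floor_pairing (combination_mem_dualLattice v x y)
  have h' := E.signExponent_eq_add_signChange hL ht ht' (by rwa [add_sub_cancel_left])
  rw [h, ← Int.cast_add] at h'
  rw [E.tilingSign_eq, E.tilingSign_eq, ← Int.negOnePow_add]
  exact negOnePow_congr h'

/-! ### Convexity of the flux set and adjacency -/

theorem floor_mul_step {θ : ℝ} (h0 : 0 ≤ θ) (h1 : θ ≤ 1) {a b : ℤ} (h : |b - a| ≤ 1) :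
    ⌊θ * b⌋ - ⌊θ * a⌋ = 0 ∨ ⌊θ * b⌋ - ⌊θ * a⌋ = b - a := by
  have key : ∀ a : ℤ, ⌊θ * a⌋ ≤ ⌊θ * (a + 1 : ℤ)⌋ ∧ ⌊θ * (a + 1 : ℤ)⌋ ≤ ⌊θ * a⌋ + 1 := by
    intro a
    constructor
    · apply Int.floor_le_floor
      push_cast; nlinarith
    · rw [← Int.floor_add_one]
      apply Int.floor_le_floor
      push_cast; nlinarith
  rw [abs_le] at h
  obtain rfl | rfl | rfl : b = a ∨ b = a + 1 ∨ a = b + 1 := by omega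
  · simp
  · have := key a; omega
  · have := key b; omega

/-- The set of fluxes is convex in its coset of the dual lattice. -/
theorem mem_fluxSet_of_mem_segment (hL : IsValidLattice L) {φ ψ : ℝ × ℝ} (hφ : φ ∈ fluxSet L)
    (hψ : ψ ∈ fluxSet L) {θ : ℝ} (h0 : 0 ≤ θ) (h1 : θ ≤ 1)
    (hd : θ • (ψ - φ) ∈ dualLattice L) : φ + θ • (ψ - φ) ∈ fluxSet L := by
  obtain ⟨t, h, ht, hφ⟩ := hφ
  obtain ⟨t', h', ht', hψ⟩ := hψ
  obtain ⟨k, hk⟩ := exists_height_difference ht ht'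
  have hper := hasPeriods_height_difference hφ hψ hk
  have hk0 : k 0 = 0 := by
    have := hk 0
    rw [ht.1, ht'.1] at this
    omega
  have hi := ((isHeightFunction_iff t h).1 ht).2
  have hi' := ((isHeightFunction_iff t' h').1 ht').2
  have h01 : ∀ (t : Tiling L) s d, dominoInd t s d = 0 ∨ dominoInd t s d = 1 := by
    intro t s d; unfold dominoInd; split_ifs <;> simp
  have hdiff : ∀ s d, sideDiff h' s d = sideDiff h s d + 4 * sideDiff k s d := by
    intro s d
    fin_cases d <;> simp [sideDiff, hk] <;> ring
  -- Interpolate the height difference by `θ * k` and round down. Along each edge the rounded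
  -- increment is zero or that of `k`, so each side increment agrees with that of one of the two
  -- tilings.
  refine exists_tiling_of_sideDiff hL (fun u => h u + 4 * ⌊θ * k u⌋) _ ?_ ?_ ?_
  · simp [ht.1, hk0]
  · intro s d
    have hs : sideDiff (fun u => h u + 4 * ⌊θ * k u⌋) s d =
        sideDiff h s d + 4 * sideDiff (fun u => ⌊θ * k u⌋) s d := by
      fin_cases d <;> simp [sideDiff] <;> ring
    have hcol : colour s = 1 ∨ colour s = -1 := by unfold colour; split_ifs <;> simp
    have a1 := hi s d
    have a2 := hi' s d
    have habs : |sideDiff k s d| ≤ 1 := by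
      rw [abs_le]
      rw [hdiff] at a2
      rcases hcol with hc | hc <;> rw [hc] at a1 a2 <;> rcases h01 t s d with e | e <;>
        rcases h01 t' s d with e' | e' <;> rw [e] at a1 <;> rw [e'] at a2 <;> omega
    have hfl : sideDiff (fun u => ⌊θ * k u⌋) s d = 0 ∨
        sideDiff (fun u => ⌊θ * k u⌋) s d = sideDiff k s d := by
      fin_cases d <;> exact floor_mul_step h0 h1 habs
    rw [hs]
    rcases hfl with e | e <;> rw [e]
    · rw [mul_zero, add_zero, a1]
      rcases h01 t s d with e | e <;> rw [e] <;> simp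
    · rw [← hdiff, a2]
      rcases h01 t' s d with e | e <;> rw [e] <;> simp
  · intro w hw u
    obtain ⟨m, hm⟩ := hd w hw
    have h2 := hper w hw u
    have h3 := hφ w hw u
    have h4 : pairing (θ • (ψ - φ)) w = θ * pairing (ψ - φ) w := by
      simp only [pairing, Prod.smul_fst, Prod.smul_snd, smul_eq_mul]; ring
    have h5 : θ * k (u + w) = θ * k u + m := by
      rw [← hm, h4, ← h2]; push_cast; ring
    rw [h5, Int.floor_add_intCast, add_pairing, hm]
    push_cast at h3 ⊢
    linarith

theorem planeDet_basis_ne_zero (hL : IsValidLattice L) (E : SquareEnumeration L n)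
    (v : Module.Basis (Fin 2) ℤ (dualLattice L)) (i : Fin 2) :
    planeDet (v i) (v (i + 1)) ≠ 0 := by
  obtain ⟨e, he, h⟩ := E.planeDet_basis hL v
  have h0 : planeDet (v 0) (v 1) ≠ 0 := by
    intro h0
    rw [h0, mul_zero] at h
    have : e = 0 := by exact_mod_cast h.symm
    exact he.ne_zero this
  fin_cases i
  · exact h0
  · intro h1
    apply h0
    have h1 : planeDet (v 1) (v 0) = 0 := h1
    rw [planeDet] at h1 ⊢
    linarith

theorem eq_repr_dualLattice_index (v : Module.Basis (Fin 2) ℤ (dualLattice L)) (i : Fin 2)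
    {φ : ℝ × ℝ} (hφ : φ ∈ dualLattice L) :
    ∃ x y : ℤ, φ = (x : ℝ) • (v i : ℝ × ℝ) + (y : ℝ) • (v (i + 1) : ℝ × ℝ) := by
  obtain ⟨x, y, h⟩ := eq_repr_dualLattice v hφ
  fin_cases i
  · exact ⟨x, y, h⟩
  · exact ⟨y, x, h.trans (add_comm _ _)⟩

theorem sub_mem_dualLattice_of_mem_fluxSet {φ ψ : ℝ × ℝ} (hφ : φ ∈ fluxSet L)
    (hψ : ψ ∈ fluxSet L) : ψ - φ ∈ dualLattice L := by
  obtain ⟨t, ht⟩ := hφ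
  obtain ⟨t', ht'⟩ := hψ
  exact sub_mem_dualLattice ht ht'

/-- A step of length at least two would, by convexity, leave a flux at the first lattice point
strictly in between. -/
theorem AdjacentFluxes.exists_eq (hL : IsValidLattice L) (E : SquareEnumeration L n)
    {v : Module.Basis (Fin 2) ℤ (dualLattice L)} {i : Fin 2} {φ φ' : ℝ × ℝ}
    (h : AdjacentFluxes L (v i) φ φ') :
    ∃ c : ℤ, |c| = 1 ∧ φ' = φ + (c : ℝ) • (v i : ℝ × ℝ) := by
  obtain ⟨hφ, hφ', hne, ⟨r, rfl⟩, hseg⟩ := h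
  obtain ⟨c, y, hc⟩ := eq_repr_dualLattice_index v i (sub_mem_dualLattice_of_mem_fluxSet hφ hφ')
  rw [add_sub_cancel_left] at hc
  have hr : r = c := by
    refine (eq_of_combination_eq (planeDet_basis_ne_zero hL E v i) (y := 0) (y' := y) ?_).1
    rw [← hc, zero_smul, add_zero]
  subst hr
  refine ⟨c, ?_, rfl⟩
  by_contra hc1
  have hc0 : c ≠ 0 := by
    rintro rfl
    exact hne (by simp)
  have hc2 : 2 ≤ |c| := by
    have := abs_pos.2 hc0
    omega
  have hc2' : (2 : ℝ) ≤ |(c : ℝ)| := by exact_mod_cast hc2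
  -- With this parameter the segment is cut exactly one lattice step away from `φ`.
  set θ : ℝ := |(c : ℝ)|⁻¹ with hθ
  have hθ0 : 0 < θ := inv_pos.2 (by linarith)
  have hθ1 : θ < 1 := inv_lt_one_of_one_lt₀ (by linarith)
  have hθc : θ * c = (Int.sign c : ℤ) := by
    rw [hθ, inv_mul_eq_iff_eq_mul₀ (by linarith)]
    rw [mul_comm]
    exact_mod_cast (Int.sign_mul_abs c).symm
  have hmem := mem_fluxSet_of_mem_segment hL hφ hφ' hθ0.le hθ1.le (by
    rw [add_sub_cancel_left, smul_smul, hθc, Int.cast_smul_eq_zsmul]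
    exact zsmul_mem (v i).2 _)
  refine hseg _ ?_ hmem
  exact ⟨1 - θ, θ, by linarith, hθ0, by ring, by module⟩

theorem exists_crossing {z : ℕ → ℤ} {m : ℕ} (h0 : z 0 = 0) (hm : 1 ≤ z m)
    (hstep : ∀ k < m, z (k + 1) ≤ z k + 1) : ∃ k ≤ m, z k = 1 := by
  induction m with
  | zero => omega
  | succ m ih =>
    by_cases h : 1 ≤ z m
    · obtain ⟨k, hk, hz⟩ := ih h fun k hk => hstep k (by omega)
      exact ⟨k, by omega, hz⟩
    · have := hstep m (by omega)
      exact ⟨m + 1, le_rfl, by omega⟩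

/-- A connecting sequence of fluxes changes the transverse coordinate by at most one per step. If
this coordinate had to change by two or more, the sequence would meet a line strictly in between. -/
theorem AdjacentLines.exists_eq (hL : IsValidLattice L) (E : SquareEnumeration L n)
    {v : Module.Basis (Fin 2) ℤ (dualLattice L)} (hv : IsFluxConnecting L v) {i : Fin 2}
    {φ ψ : ℝ × ℝ} (h : AdjacentLines L (v i) φ ψ) :
    ∃ x c : ℤ, |c| = 1 ∧
      ψ = φ + ((x : ℝ) • (v i : ℝ × ℝ) + (c : ℝ) • (v (i + 1) : ℝ × ℝ)) := by
  obtain ⟨hφ, hψ, hline, hseg⟩ := h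
  obtain ⟨x, c, hc⟩ := eq_repr_dualLattice_index v i (sub_mem_dualLattice_of_mem_fluxSet hφ hψ)
  refine ⟨x, c, ?_, by rw [← hc]; abel⟩
  by_contra hc1
  have hc0 : c ≠ 0 := by
    rintro rfl
    refine hline ⟨x, ?_⟩
    rw [Int.cast_zero, zero_smul, add_zero] at hc
    rw [← hc]; abel
  have hc2 : 2 ≤ |c| := by
    have := abs_pos.2 hc0
    omega
  have hc2' : (2 : ℝ) ≤ |(c : ℝ)| := by exact_mod_cast hc2
  set θ : ℝ := |(c : ℝ)|⁻¹ with hθ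
  have hθ0 : 0 < θ := inv_pos.2 (by linarith)
  have hθ1 : θ < 1 := inv_lt_one_of_one_lt₀ (by linarith)
  have hθc : θ * c = (Int.sign c : ℤ) := by
    rw [hθ, inv_mul_eq_iff_eq_mul₀ (by linarith)]
    rw [mul_comm]
    exact_mod_cast (Int.sign_mul_abs c).symm
  obtain ⟨m, f, hf0, hfm, hfF, hfs⟩ := hv φ hφ ψ hψ
  have hdet := planeDet_basis_ne_zero hL E v i
  -- The bound `k ≤ m` is placed inside the existential so that `a` and `b` are total sequences;
  -- their values beyond `m` play no role.
  have hrep : ∀ k, ∃ a b : ℤ, k ≤ m →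
      f k - φ = (a : ℝ) • (v i : ℝ × ℝ) + (b : ℝ) • (v (i + 1) : ℝ × ℝ) := by
    intro k
    by_cases hk : k ≤ m
    · obtain ⟨a, b, hab⟩ := eq_repr_dualLattice_index v i
        (sub_mem_dualLattice_of_mem_fluxSet hφ (hfF k hk))
      exact ⟨a, b, fun _ => hab⟩
    · exact ⟨0, 0, fun h => absurd h hk⟩
  choose a b hab using hrep
  have hb0 : b 0 = 0 := by
    have h := hab 0 (Nat.zero_le _)
    rw [hf0, sub_self] at h
    have := (eq_of_combination_eq hdet (x := 0) (y := 0) (by rw [← h]; simp)).2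
    exact_mod_cast this.symm
  have hbm : b m = c := by
    have h := hab m le_rfl
    rw [hfm, hc] at h
    have := (eq_of_combination_eq hdet h).2
    exact_mod_cast this.symm
  have hbs : ∀ k < m, |b (k + 1) - b k| ≤ 1 := by
    intro k hk
    have h1 := hab k hk.le
    have h2 := hab (k + 1) hk
    have hstep : ∃ p q : ℤ, |q| ≤ 1 ∧
        f (k + 1) - f k = (p : ℝ) • (v i : ℝ × ℝ) + (q : ℝ) • (v (i + 1) : ℝ × ℝ) := by
      obtain ⟨j, hj⟩ := hfs k hk
      have hij : j = i ∨ j = i + 1 := by omega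
      rcases hij with rfl | rfl <;> rcases hj with hj | hj <;> rw [hj]
      · exact ⟨1, 0, by simp, by simp⟩
      · exact ⟨-1, 0, by simp, by simp⟩
      · exact ⟨0, 1, by simp, by simp⟩
      · exact ⟨0, -1, by simp, by simp⟩
    obtain ⟨p, q, hq, hpq⟩ := hstep
    have h3 : ((a k + p : ℤ) : ℝ) • (v i : ℝ × ℝ) + ((b k + q : ℤ) : ℝ) • (v (i + 1) : ℝ × ℝ) =
        (a (k + 1) : ℝ) • (v i : ℝ × ℝ) + (b (k + 1) : ℝ) • (v (i + 1) : ℝ × ℝ) := by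
      rw [← h2, ← sub_add_sub_cancel _ (f k) φ, h1, hpq]
      push_cast
      module
    have h4 : b k + q = b (k + 1) := by exact_mod_cast (eq_of_combination_eq hdet h3).2
    rw [← h4, add_sub_cancel_left]
    exact hq
  have hsgn : Int.sign c = 1 ∨ Int.sign c = -1 := by
    rcases lt_or_gt_of_ne hc0 with h | h
    · exact Or.inr (Int.sign_eq_neg_one_of_neg h)
    · exact Or.inl (Int.sign_eq_one_of_pos h)
  obtain ⟨k, hk, hz⟩ := exists_crossing (z := fun k => Int.sign c * b k) (m := m)
    (by simp [hb0]) (by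
      rw [hbm, Int.sign_mul_self_eq_abs]
      omega) (by
      intro k hk
      have := abs_le.1 (hbs k hk)
      rcases hsgn with h | h <;> rw [h] <;> omega)
  have hbk : b k = Int.sign c := by
    rcases hsgn with h | h <;> rw [h] at hz ⊢ <;> omega
  -- This point of the segment and the flux `f k` both have transverse coordinate `Int.sign c`, so
  -- they differ by a multiple of `v i`.
  refine hseg (φ + θ • (ψ - φ)) ⟨1 - θ, θ, by linarith, hθ0, by ring, by module⟩ (f k) (hfF k hk)
    ⟨a k - θ * x, ?_⟩
  have h1 := hab k hk
  rw [hbk, ← hθc] at h1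
  rw [hc, eq_add_of_sub_eq h1]
  module

/-! ### The sign of a flux -/

open Classical in
/-- The common sign of all tilings with flux `φ`. -/
noncomputable def SquareEnumeration.fluxSign (E : SquareEnumeration L n) (φ : ℝ × ℝ) : ℤˣ :=
  if h : ∃ t : Tiling L, HasFlux t φ then E.tilingSign h.choose else 1

theorem SquareEnumeration.fluxSign_eq (hL : IsValidLattice L) (E : SquareEnumeration L n)
    (v : Module.Basis (Fin 2) ℤ (dualLattice L)) {t : Tiling L} {φ : ℝ × ℝ} (ht : HasFlux t φ) :
    E.fluxSign φ = E.tilingSign t := by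
  have h : ∃ t : Tiling L, HasFlux t φ := ⟨t, ht⟩
  obtain ⟨α, β, hαβ⟩ := E.exists_tilingSign_eq hL v ht
  rw [fluxSign, dif_pos h, hαβ h.choose 0 0 (by simpa using h.choose_spec)]
  simp

theorem SquareEnumeration.exists_fluxSign_eq (hL : IsValidLattice L) (E : SquareEnumeration L n)
    (v : Module.Basis (Fin 2) ℤ (dualLattice L)) {φ : ℝ × ℝ} (hφ : φ ∈ fluxSet L) (i : Fin 2) :
    ∃ s α β : ℤ, ∀ x y : ℤ,
      φ + ((x : ℝ) • (v i : ℝ × ℝ) + (y : ℝ) • (v (i + 1) : ℝ × ℝ)) ∈ fluxSet L →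
        E.fluxSign (φ + ((x : ℝ) • (v i : ℝ × ℝ) + (y : ℝ) • (v (i + 1) : ℝ × ℝ))) =
          (s + (α * x + β * y + x * y)).negOnePow := by
  obtain ⟨t, ht⟩ := hφ
  obtain ⟨α, β, h⟩ := E.exists_tilingSign_eq hL v ht
  have key : ∀ x y : ℤ, φ + ((x : ℝ) • (v 0 : ℝ × ℝ) + (y : ℝ) • (v 1 : ℝ × ℝ)) ∈ fluxSet L →
        E.fluxSign (φ + ((x : ℝ) • (v 0 : ℝ × ℝ) + (y : ℝ) • (v 1 : ℝ × ℝ))) =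
          (E.signExponent (dominoInd t) + (α * x + β * y + x * y)).negOnePow := by
    rintro x y ⟨t', ht'⟩
    rw [E.fluxSign_eq hL v ht', h t' x y ht', E.tilingSign_eq, ← Int.negOnePow_add]
  fin_cases i
  · exact ⟨_, α, β, key⟩
  · refine ⟨E.signExponent (dominoInd t), β, α, fun x y hxy => ?_⟩
    have e : ((x : ℝ) • (v 1 : ℝ × ℝ) + (y : ℝ) • (v 0 : ℝ × ℝ)) =
      (y : ℝ) • (v 0 : ℝ × ℝ) + (x : ℝ) • (v 1 : ℝ × ℝ) := add_comm _ _
    change φ + ((x : ℝ) • (v 1 : ℝ × ℝ) + (y : ℝ) • (v 0 : ℝ × ℝ)) ∈ fluxSet L at hxy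
    change E.fluxSign (φ + ((x : ℝ) • (v 1 : ℝ × ℝ) + (y : ℝ) • (v 0 : ℝ × ℝ))) = _
    rw [e] at hxy ⊢
    rw [key y x hxy]
    congr 1
    ring

/-- A step `±1` in `x` changes `α * x + β * y + x * y` by `α + y` modulo 2, so moving by `d` in the
transverse coordinate alters the quotient by `(-1) ^ d`. -/
theorem SquareEnumeration.fluxSign_div_eq (hL : IsValidLattice L) (E : SquareEnumeration L n)
    (v : Module.Basis (Fin 2) ℤ (dualLattice L)) {i : Fin 2} {φ φ' ψ ψ' : ℝ × ℝ}
    (hφ : AdjacentFluxes L (v i) φ φ') (hψ : AdjacentFluxes L (v i) ψ ψ') {x d : ℤ}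
    (hd : ψ = φ + ((x : ℝ) • (v i : ℝ × ℝ) + (d : ℝ) • (v (i + 1) : ℝ × ℝ))) :
    E.fluxSign φ / E.fluxSign φ' = d.negOnePow * (E.fluxSign ψ / E.fluxSign ψ') := by
  obtain ⟨s, α, β, h⟩ := E.exists_fluxSign_eq hL v hφ.1 i
  obtain ⟨c, hc, hφ'⟩ := hφ.exists_eq hL E
  obtain ⟨c', hc', hψ'⟩ := hψ.exists_eq hL E
  have e1 : φ = φ + (((0 : ℤ) : ℝ) • (v i : ℝ × ℝ) + ((0 : ℤ) : ℝ) • (v (i + 1) : ℝ × ℝ)) := by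
    simp
  have e2 : φ' = φ + (((c : ℤ) : ℝ) • (v i : ℝ × ℝ) + ((0 : ℤ) : ℝ) • (v (i + 1) : ℝ × ℝ)) := by
    rw [hφ']; simp
  have e3 : ψ' = φ + (((x + c' : ℤ) : ℝ) • (v i : ℝ × ℝ) + (d : ℝ) • (v (i + 1) : ℝ × ℝ)) := by
    rw [hψ', hd]; push_cast; module
  have s1 := h 0 0 (e1 ▸ hφ.1)
  have s2 := h c 0 (e2 ▸ hφ.2.1)
  have s3 := h x d (hd ▸ hψ.1)
  have s4 := h (x + c') d (e3 ▸ hψ.2.1)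
  rw [← e1] at s1
  rw [← e2] at s2
  rw [← hd] at s3
  rw [← e3] at s4
  rw [s1, s2, s3, s4, Int.units_div_eq_mul, Int.units_div_eq_mul, ← Int.negOnePow_sub, ← Int.negOnePow_sub, ← Int.negOnePow_add,
    Int.negOnePow_eq_iff]
  rcases (abs_eq zero_le_one).1 hc with rfl | rfl <;>
    rcases (abs_eq zero_le_one).1 hc' with rfl | rfl
  · exact ⟨0, by ring⟩
  · exact ⟨-α - d, by ring⟩
  · exact ⟨α, by ring⟩
  · exact ⟨-d, by ring⟩

end DominoTorus

open DominoTorus in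
/-- Sign patterns in the set of fluxes: the sign of a flux is well defined, the sign change between
adjacent fluxes is constant along each line parallel to a vector of the basis, it is opposite on
adjacent parallel lines, and one of the two signs is the odd one out. -/
theorem mainTheorem7 (L : AddSubgroup (ℤ × ℤ)) (hL : IsValidLattice L)
    (n : ℕ) (E : SquareEnumeration L n)
    (v : Module.Basis (Fin 2) ℤ (dualLattice L)) (hv : IsFluxConnecting L v) :
    ∃ sgn : ℝ × ℝ → ℤˣ,
      (∀ (t : Tiling L) (φ : ℝ × ℝ), HasFlux t φ → sgn φ = E.tilingSign t) ∧
      (∀ (i : Fin 2) (φ φ' ψ ψ' : ℝ × ℝ),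
        AdjacentFluxes L (v i) φ φ' → AdjacentFluxes L (v i) ψ ψ' →
        SameLine (v i) φ ψ → sgn φ / sgn φ' = sgn ψ / sgn ψ') ∧
      (∀ (i : Fin 2) (φ φ' ψ ψ' : ℝ × ℝ),
        AdjacentFluxes L (v i) φ φ' → AdjacentFluxes L (v i) ψ ψ' →
        AdjacentLines L (v i) φ ψ → sgn φ / sgn φ' = -(sgn ψ / sgn ψ')) ∧
      ∃ ε : ℤˣ,
        (∀ φ ∈ fluxSet L, sgn φ = ε → ∀ a b : ℤ, |a| ≤ 1 → |b| ≤ 1 → (a, b) ≠ (0, 0) →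
          φ + ((a • v 0 + b • v 1 : dualLattice L) : ℝ × ℝ) ∈ fluxSet L →
          sgn (φ + ((a • v 0 + b • v 1 : dualLattice L) : ℝ × ℝ)) = -ε) ∧
        (∀ φ : ℝ × ℝ,
          (∀ c : Fin 2 → Fin 2,
            φ + ((∑ i, (c i : ℕ) • v i : dualLattice L) : ℝ × ℝ) ∈ fluxSet L) →
          ∃! c : Fin 2 → Fin 2,
            sgn (φ + ((∑ i, (c i : ℕ) • v i : dualLattice L) : ℝ × ℝ)) = ε) := by
  refine ⟨E.fluxSign, fun t φ ht => E.fluxSign_eq hL v ht, ?_, ?_, ?_⟩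
  · intro i φ φ' ψ ψ' hφ hψ hline
    obtain ⟨x, d, hd⟩ := eq_repr_dualLattice_index v i
      (sub_mem_dualLattice_of_mem_fluxSet hφ.1 hψ.1)
    obtain ⟨r, hr⟩ := hline
    have hd0 : d = 0 := by
      have := (eq_of_combination_eq (planeDet_basis_ne_zero hL E v i) (x := r) (y := 0)
        (by rw [← hd, hr, zero_smul, add_zero, add_sub_cancel_left])).2
      exact_mod_cast this.symm
    rw [E.fluxSign_div_eq hL v hφ hψ (x := x) (d := d) (by rw [← hd]; abel), hd0]
    simp
  · intro i φ φ' ψ ψ' hφ hψ hline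
    obtain ⟨x, d, hd, hψφ⟩ := hline.exists_eq hL E hv
    rw [E.fluxSign_div_eq hL v hφ hψ hψφ]
    rcases (abs_eq zero_le_one).1 hd with rfl | rfl <;> simp
  · by_cases hne : ∃ φ₀, φ₀ ∈ fluxSet L
    · obtain ⟨φ₀, hφ₀⟩ := hne
      obtain ⟨s, α, β, h⟩ := E.exists_fluxSign_eq hL v hφ₀ 0
      -- Completing the product turns the exponent into a constant plus `(x + β) * (y + α)`, so the
      -- sign is exceptional exactly when both factors are odd.
      have h : ∀ x y : ℤ,
          φ₀ + ((x : ℝ) • (v 0 : ℝ × ℝ) + (y : ℝ) • (v 1 : ℝ × ℝ)) ∈ fluxSet L →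
          E.fluxSign (φ₀ + ((x : ℝ) • (v 0 : ℝ × ℝ) + (y : ℝ) • (v 1 : ℝ × ℝ))) =
            (s - α * β + (x + β) * (y + α)).negOnePow := by
        intro x y hxy
        refine (h x y hxy).trans ?_
        congr 1
        ring
      have hiff : ∀ x y : ℤ,
          φ₀ + ((x : ℝ) • (v 0 : ℝ × ℝ) + (y : ℝ) • (v 1 : ℝ × ℝ)) ∈ fluxSet L →
          (E.fluxSign (φ₀ + ((x : ℝ) • (v 0 : ℝ × ℝ) + (y : ℝ) • (v 1 : ℝ × ℝ))) =
            (s - α * β + 1).negOnePow ↔ Odd (x + β) ∧ Odd (y + α)) := by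
        intro x y hxy
        rw [h x y hxy, Int.negOnePow_eq_iff, ← Int.odd_mul, add_sub_add_left_eq_sub, Int.even_sub]
        simp
      have hcoe : ∀ (x y a b : ℤ) (φ : ℝ × ℝ),
          φ - φ₀ = (x : ℝ) • (v 0 : ℝ × ℝ) + (y : ℝ) • (v 1 : ℝ × ℝ) →
          φ + ((a • v 0 + b • v 1 : dualLattice L) : ℝ × ℝ) =
            φ₀ + (((x + a : ℤ) : ℝ) • (v 0 : ℝ × ℝ) + ((y + b : ℤ) : ℝ) • (v 1 : ℝ × ℝ)) := by
        intro x y a b φ hφ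
        rw [eq_add_of_sub_eq hφ]
        simp only [AddSubgroup.coe_add, AddSubgroup.coe_zsmul, ← Int.cast_smul_eq_zsmul ℝ]
        push_cast
        module
      refine ⟨(s - α * β + 1).negOnePow, ?_, ?_⟩
      · intro φ hφ hsgn a b ha hb hab hmem
        obtain ⟨x, y, hxy⟩ := eq_repr_dualLattice v (sub_mem_dualLattice_of_mem_fluxSet hφ₀ hφ)
        have e : φ = φ₀ + ((x : ℝ) • (v 0 : ℝ × ℝ) + (y : ℝ) • (v 1 : ℝ × ℝ)) := by
          rw [← hxy]; abel
        rw [e] at hφ hsgn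
        obtain ⟨hx, hy⟩ := (hiff x y hφ).1 hsgn
        rw [hcoe x y a b φ hxy] at hmem ⊢
        -- A nonzero shift with entries in `{-1, 0, 1}` changes the parity of at least one factor.
        have hnot : ¬ (Odd (x + a + β) ∧ Odd (y + b + α)) := by
          rintro ⟨hx', hy'⟩
          rw [Int.odd_iff] at hx hy hx' hy'
          rw [abs_le] at ha hb
          apply hab
          ext <;> simp only <;> omega
        rw [← hiff _ _ hmem] at hnot
        exact (Int.units_ne_iff_eq_neg).1 hnot
      · intro φ hφ
        have hsum : ∀ c : Fin 2 → Fin 2, ((∑ i, (c i : ℕ) • v i : dualLattice L) : ℝ × ℝ) =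
            ((((c 0 : ℕ) : ℤ) • v 0 + ((c 1 : ℕ) : ℤ) • v 1 : dualLattice L) : ℝ × ℝ) := by
          intro c
          rw [Fin.sum_univ_two, natCast_zsmul, natCast_zsmul]
        have hmem : φ ∈ fluxSet L := by
          have := hφ 0
          simpa using this
        obtain ⟨x, y, hxy⟩ := eq_repr_dualLattice v (sub_mem_dualLattice_of_mem_fluxSet hφ₀ hmem)
        have hc : ∀ c : Fin 2 → Fin 2,
            (E.fluxSign (φ + ((∑ i, (c i : ℕ) • v i : dualLattice L) : ℝ × ℝ)) =
              (s - α * β + 1).negOnePow ↔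
            Odd (x + ((c 0 : ℕ) : ℤ) + β) ∧ Odd (y + ((c 1 : ℕ) : ℤ) + α)) := by
          intro c
          have hm := hφ c
          rw [hsum, hcoe x y _ _ φ hxy] at hm ⊢
          exact hiff _ _ hm
        -- In each coordinate one of the two bits makes the factor odd, and parity forces which one.
        -- This singles out one corner of the unit cell.
        have hbit : ∀ m : ℤ, ∃ c : Fin 2, Odd (m + ((c : ℕ) : ℤ)) := by
          intro m
          rcases Int.even_or_odd m with hm | hm
          · exact ⟨1, hm.add_one⟩
          · exact ⟨0, by simpa using hm⟩
        obtain ⟨c₀, h₀⟩ := hbit (x + β)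
        obtain ⟨c₁, h₁⟩ := hbit (y + α)
        refine ⟨![c₀, c₁], (hc _).2 ?_, ?_⟩
        · simp only [Matrix.cons_val]
          exact ⟨by rwa [add_right_comm], by rwa [add_right_comm]⟩
        · intro c hcc
          obtain ⟨g₀, g₁⟩ := (hc c).1 hcc
          rw [Int.odd_iff] at h₀ h₁ g₀ g₁
          have b0 := (c 0).2
          have b1 := (c 1).2
          have b2 := c₀.2
          have b3 := c₁.2
          have q0 : c 0 = c₀ := Fin.ext (by omega)
          have q1 : c 1 = c₁ := Fin.ext (by omega)
          ext i
          fin_cases i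
          · exact congrArg Fin.val q0
          · exact congrArg Fin.val q1
    · refine ⟨1, fun φ hφ => absurd ⟨φ, hφ⟩ hne, fun φ hφ => absurd ⟨_, hφ 0⟩ hne⟩
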